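/- **Setting.** Let $1\le k<n$ and $q\ge 1$, let $X$ be a real $n\times k$ matrix of rank $k$, $R$ a real $q\times k$ matrix of rank $q$, and $r\in\mathbb R^q$. Put $\mathfrak M=\operatorname{span}(X)$ (column space), $\mathfrak M_0=\{X\beta: R\beta=r\}$, $\mathfrak M_1=\mathfrak M\setminus\mathfrak M_0$, and $\hat\beta(y)=(X'X)^{-1}X'y$. Let $\Lambda(\rho)=(\rho^{|i-j|})_{i,j=1}^n$ for $\rho\in(-1,1)$, $e_+=(1,\dots,1)'\in\mathbb R^n$, $e_-=(-1,1,\dots,(-1)^n)'\in\mathbb R^n$. $P_{\mu,\Phi}$ is the Gaussian distribution on $\mathbb R^n$ with mean $\mu$ and covariance matrix $\Phi$, $d$ is Euclidean distance, and $\sigma$ is the positive root of $\sigma^2$. Let $w(j)$, $|j|\le n-1$, be real (data-independent) weights with $w(0)=1$, $w(-j)=w(j)$, and such that the $n\times n$ matrix $(w(i-j))_{i,j}$ is positive definite. A pair $(\bar X,\bar R)$, with $\bar X$ an $n\times\bar k$ matrix of rank $\bar k$ and $\bar R$ a $q\times\bar k$ matrix, is said to satisfy condition (D) if $\bar R(\bar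 X'\bar X)^{-1}\bar X'(\lnot)$ has rank $q$, where $\bar X'(\lnot)$ arises from $\bar X'$ by deleting all columns whose index $i$ is such that the $i$-th standard basis vector of $\mathbb R^n$ lies in $\operatorname{span}(\bar X)$. **Scenarios.** Suppose that one of the following holds, where in each case $\bar X=(X,Z)$ with $Z$ an $n\times p$ matrix of auxiliary regressors, $\bar R=(R,0)$ is $q\times(k+p)$, $k+p<n$, and $(\bar X,\bar R)$ satisfies (D): 1. $e_+\in\mathfrak M$, $R\hat\beta(e_+)=0$, $e_-\notin\mathfrak M$; $Z=e_-$. 2. $e_+\notin\mathfrak M$, $e_-\in\mathfrak M$, $R\hat\beta(e_-)=0$; $Z=e_+$. 3. $e_+,e_-\notin\mathfrak M$, $\operatorname{rank}(X,e_+,e_-)=k+2$; $Z=(e_+,e_-)$. 4. $e_+,e_-\notin\mathfrak M$, $\operatorname{rank}(X,e_+,e_-)=k+1$; $Z=e_+$; and $\bar R(\bar X'\bar X)^{-1}\bar X'e_-=0$. 5. $e_+,e_-\notin\mathfrak M$, $\operatorname{rank}(X,e_+,e_-)=k+1$; $Z=e_-$; and $\bar R(\bar X'\bar X)^{-1}\bar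 X'e_+=0$. **Adjusted test.** Let $\bar\beta(y)=(I_k,0)(\bar X'\bar X)^{-1}\bar X'y$, let $\bar u(y)=y-\bar X(\bar X'\bar X)^{-1}\bar X'y$, $\bar v_t(y)=\bar u_t(y)\bar x_{t\cdot}'$ with $\bar x_{t\cdot}$ the $t$-th row of $\bar X$, $\bar\Gamma_j(y)=n^{-1}\sum_{t=j+1}^n\bar v_t(y)\bar v_{t-j}(y)'$ for $j\ge0$, $\bar\Gamma_j(y)=\bar\Gamma_{-j}(y)'$ for $j<0$, $\bar\Psi_w(y)=\sum_{j=-(n-1)}^{n-1}w(j)\bar\Gamma_j(y)$, and $\bar\Omega_w(y)=n\bar R(\bar X'\bar X)^{-1}\bar\Psi_w(y)(\bar X'\bar X)^{-1}\bar R'$. Put $\bar T(y)=(R\bar\beta(y)-r)'\bar\Omega_w^{-1}(y)(R\bar\beta(y)-r)$ if $\det\bar\Omega_w(y)\ne0$ and $\bar T(y)=0$ otherwise, and $\bar W(C)=\{y\in\mathbb R^n:\bar T(y)\ge C\}$ for $0<C<\infty$. **Theorem.** In each of the five scenarios the following holds for every $0<C<\infty$. 1. (Size) $\displaystyle\sup_{\mu_0\in\mathfrak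 M_0}\sup_{0<\sigma^2<\infty}\sup_{-1<\rho<1}P_{\mu_0,\sigma^2\Lambda(\rho)}(\bar W(C))<1$ and $\displaystyle\inf_{\mu_0\in\mathfrak M_0}\inf_{0<\sigma^2<\infty}\inf_{-1<\rho<1}P_{\mu_0,\sigma^2\Lambda(\rho)}(\bar W(C))>0$. 2. (Infimal power) $\displaystyle\inf_{\mu_1\in\mathfrak M_1}\inf_{0<\sigma^2<\infty}\inf_{-1<\rho<1}P_{\mu_1,\sigma^2\Lambda(\rho)}(\bar W(C))>0$. 3. (a) For every $0<c<\infty$ and every sequence $\rho_m\in(-1,1)$ with $|\rho_m|\to1$, $$\inf_{\mu_1\in\mathfrak M_1,\,0<\sigma^2<\infty,\,d(\mu_1,\mathfrak M_0)/\sigma\ge c}P_{\mu_1,\sigma^2\Lambda(\rho_m)}(\bar W(C))\to1\quad(m\to\infty).$$ (b) For all sequences $0<c_m<\infty$ and $0<\sigma_m^2<\infty$ with $c_m/\sigma_m\to\infty$ and every $0<\varepsilon<1$, $$\inf_{\mu_1\in\mathfrak M_1,\,d(\mu_1,\mathfrak M_0)\ge c_m}\ \inf_{-1+\varepsilon\le\rho\le1-\varepsilon}P_{\mu_1,\sigma_m^2\Lambda(\rho)}(\bar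 W(C))\to1\quad(m\to\infty).$$ 4. (Controllable size) For every $0<\delta<1$ there is a $C(\delta)$, $0<C(\delta)<\infty$, with $\displaystyle\sup_{\mu_0\in\mathfrak M_0}\sup_{0<\sigma^2<\infty}\sup_{-1<\rho<1}P_{\mu_0,\sigma^2\Lambda(\rho)}(\bar W(C(\delta)))\le\delta$. Moreover, (3)(b) does not need the scenario's conditions on $e_+$ and $e_-$: it holds for every $0<C<\infty$ whenever $Z$ is $e_-$, $e_+$ or $(e_+,e_-)$, $\bar X=(X,Z)$ has rank $k+p<n$, and $(\bar X,\bar R)$ satisfies (D). -/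

import Mathlib

namespace HAR

open Matrix MeasureTheory

/-- The vector `e₊ = (1, …, 1)'`. -/
def ePlus (n : ℕ) : Fin n → ℝ := fun _ => 1

/-- The vector `e₋ = (-1, 1, …, (-1)ⁿ)'`; `t : Fin n` counts from zero. -/
def eMinus (n : ℕ) : Fin n → ℝ := fun t => (-1) ^ ((t : ℕ) + 1)

/-- The AR(1) correlation matrix `Λ(ρ)` with entries `ρ ^ |i - j|`. -/
def ar1Corr (n : ℕ) (ρ : ℝ) : Matrix (Fin n) (Fin n) ℝ :=
  Matrix.of fun i j => ρ ^ ((i : ℤ) - (j : ℤ)).natAbs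

/-- The rejection probability `P_{μ, σ²Λ(ρ)}(W)` in the Gaussian AR(1) model. -/
noncomputable def prob {n : ℕ} (μ : EuclideanSpace ℝ (Fin n)) (σ2 ρ : ℝ)
    (W : Set (EuclideanSpace ℝ (Fin n))) : ENNReal :=
  ProbabilityTheory.multivariateGaussian μ (σ2 • ar1Corr n ρ) W

/-- The column space of a matrix. -/
def colSpan {n : ℕ} {ι : Type*} (X : Matrix (Fin n) ι ℝ) : Submodule ℝ (Fin n → ℝ) :=
  Submodule.span ℝ (Set.range X.col)

/-- The set `𝔐 = span(X)` of all mean vectors. -/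
def meanSpace {n k : ℕ} (X : Matrix (Fin n) (Fin k) ℝ) : Set (EuclideanSpace ℝ (Fin n)) :=
  {μ | μ.ofLp ∈ colSpan X}

/-- The null hypothesis `𝔐₀ = {μ ∈ 𝔐 : μ = Xβ and Rβ = r}`. -/
def nullSet {n k q : ℕ} (X : Matrix (Fin n) (Fin k) ℝ) (R : Matrix (Fin q) (Fin k) ℝ)
    (r : Fin q → ℝ) : Set (EuclideanSpace ℝ (Fin n)) :=
  {μ | ∃ β : Fin k → ℝ, μ.ofLp = X *ᵥ β ∧ R *ᵥ β = r}

/-- The alternative `𝔐₁ = 𝔐 \ 𝔐₀`. -/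
def altSet {n k q : ℕ} (X : Matrix (Fin n) (Fin k) ℝ) (R : Matrix (Fin q) (Fin k) ℝ)
    (r : Fin q → ℝ) : Set (EuclideanSpace ℝ (Fin n)) :=
  meanSpace X \ nullSet X R r

/-- The conditions on the weights `w(j, n)`, `|j| ≤ n - 1` (values of `w` at other integers play no
role): `w(0) = 1`, symmetry, and positive definiteness of the Toeplitz matrix `(w(i - j))`. -/
structure WeightCondition (n : ℕ) (w : ℤ → ℝ) : Prop where
  zero : w 0 = 1
  symm : ∀ j : ℤ, |j| < n → w (-j) = w j
  posDef : (Matrix.of fun i j : Fin n => w ((i : ℤ) - (j : ℤ))).PosDef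

section Regression

variable {n q : ℕ} {ι : Type*} [Fintype ι] [DecidableEq ι]

/-- The least squares estimator `(X'X)⁻¹X'y`. -/
noncomputable def ols (X : Matrix (Fin n) ι ℝ) (y : Fin n → ℝ) : ι → ℝ :=
  ((Xᵀ * X)⁻¹ * Xᵀ) *ᵥ y

/-- The least squares residuals `y - X(X'X)⁻¹X'y`. -/
noncomputable def resid (X : Matrix (Fin n) ι ℝ) (y : Fin n → ℝ) : Fin n → ℝ :=
  y - X *ᵥ ols X y

/-- The vectors `v_t(y) = u_t(y) x_{t·}'`. -/
noncomputable def score (X : Matrix (Fin n) ι ℝ) (y : Fin n → ℝ) (t : Fin n) : ι → ℝ :=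
  resid X y t • X.row t

/-- `Γ_j(y) = n⁻¹ ∑_{t=j+1}^n v_t(y) v_{t-j}(y)'` for `j ≥ 0`; the pairs `(t, s)` with
`t = s + j` are exactly the pairs `(t, t - j)` of the sum. -/
noncomputable def autocovNat (X : Matrix (Fin n) ι ℝ) (y : Fin n → ℝ) (j : ℕ) : Matrix ι ι ℝ :=
  (n : ℝ)⁻¹ • ∑ t : Fin n, ∑ s : Fin n,
    if (t : ℕ) = (s : ℕ) + j then vecMulVec (score X y t) (score X y s) else 0

/-- The sample autocovariances `Γ_j(y)`, with `Γ_j(y) = Γ_{-j}(y)'` for `j < 0`. -/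
noncomputable def autocov (X : Matrix (Fin n) ι ℝ) (y : Fin n → ℝ) (j : ℤ) : Matrix ι ι ℝ :=
  if 0 ≤ j then autocovNat X y j.natAbs else (autocovNat X y j.natAbs)ᵀ

/-- `Ψ_w(y) = ∑_{j=-(n-1)}^{n-1} w(j) Γ_j(y)`. -/
noncomputable def psi (w : ℤ → ℝ) (X : Matrix (Fin n) ι ℝ) (y : Fin n → ℝ) : Matrix ι ι ℝ :=
  ∑ j ∈ Finset.Icc (-((n : ℤ) - 1)) ((n : ℤ) - 1), w j • autocov X y j

/-- `Ω_w(y) = n R (X'X)⁻¹ Ψ_w(y) (X'X)⁻¹ R'`. -/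
noncomputable def omega (w : ℤ → ℝ) (X : Matrix (Fin n) ι ℝ) (R : Matrix (Fin q) ι ℝ)
    (y : Fin n → ℝ) : Matrix (Fin q) (Fin q) ℝ :=
  (n : ℝ) • (R * (Xᵀ * X)⁻¹ * psi w X y * (Xᵀ * X)⁻¹ * Rᵀ)

/-- The rank condition on `(X, R)`: after deleting from `X'` the columns with those indices `i`
for which the standard basis vector `e_i(n)` lies in `span(X)`, the matrix
`R (X'X)⁻¹ X'(¬ …)` has rank `q`. -/
def DesignCondition (X : Matrix (Fin n) ι ℝ) (R : Matrix (Fin q) ι ℝ) : Prop :=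
  open Classical in
  (R * (Xᵀ * X)⁻¹ *
    Xᵀ.submatrix id
      (Subtype.val : {i : Fin n // (Pi.single i 1 : Fin n → ℝ) ∉ colSpan X} → Fin n)).rank = q

end Regression

section Adjusted

variable {n k q p : ℕ}

/-- The enlarged design matrix `X̄ = (X, Z)`. -/
abbrev augX (X : Matrix (Fin n) (Fin k) ℝ) (Z : Matrix (Fin n) (Fin p) ℝ) :
    Matrix (Fin n) (Fin k ⊕ Fin p) ℝ :=
  Matrix.fromCols X Z

/-- The enlarged restriction matrix `R̄ = (R, 0)`. -/
abbrev augR (R : Matrix (Fin q) (Fin k) ℝ) (p : ℕ) : Matrix (Fin q) (Fin k ⊕ Fin p) ℝ :=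
  Matrix.fromCols R 0

/-- `β̄(y) = (I_k, 0) (X̄'X̄)⁻¹ X̄' y`. -/
noncomputable def betaBar (X : Matrix (Fin n) (Fin k) ℝ) (Z : Matrix (Fin n) (Fin p) ℝ)
    (y : Fin n → ℝ) : Fin k → ℝ :=
  (Matrix.fromCols (1 : Matrix (Fin k) (Fin k) ℝ) (0 : Matrix (Fin k) (Fin p) ℝ)) *ᵥ
    ols (augX X Z) y

/-- `Ω̄_w(y)`, computed from the regression of `y` on `X̄`. -/
noncomputable def omegaBar (w : ℤ → ℝ) (X : Matrix (Fin n) (Fin k) ℝ)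
    (Z : Matrix (Fin n) (Fin p) ℝ) (R : Matrix (Fin q) (Fin k) ℝ) (y : Fin n → ℝ) :
    Matrix (Fin q) (Fin q) ℝ :=
  omega w (augX X Z) (augR R p) y

open Classical in
/-- The adjusted test statistic `T̄(y)`. -/
noncomputable def TBar (w : ℤ → ℝ) (X : Matrix (Fin n) (Fin k) ℝ)
    (Z : Matrix (Fin n) (Fin p) ℝ) (R : Matrix (Fin q) (Fin k) ℝ) (r : Fin q → ℝ)
    (y : Fin n → ℝ) : ℝ :=
  if (omegaBar w X Z R y).det ≠ 0 then
    (R *ᵥ betaBar X Z y - r) ⬝ᵥ ((omegaBar w X Z R y)⁻¹ *ᵥ (R *ᵥ betaBar X Z y - r))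
  else 0

/-- The rejection region `W̄(C) = {y : T̄(y) ≥ C}`. -/
def WBar (w : ℤ → ℝ) (X : Matrix (Fin n) (Fin k) ℝ) (Z : Matrix (Fin n) (Fin p) ℝ)
    (R : Matrix (Fin q) (Fin k) ℝ) (r : Fin q → ℝ) (C : ℝ) : Set (EuclideanSpace ℝ (Fin n)) :=
  {y | C ≤ TBar w X Z R r y.ofLp}

end Adjusted

/-- `e₊` as an `n × 1` matrix. -/
def colPlus (n : ℕ) : Matrix (Fin n) (Fin 1) ℝ := Matrix.of fun t => ![ePlus n t]

/-- `e₋` as an `n × 1` matrix. -/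
def colMinus (n : ℕ) : Matrix (Fin n) (Fin 1) ℝ := Matrix.of fun t => ![eMinus n t]

/-- `(e₊, e₋)` as an `n × 2` matrix. -/
def colBoth (n : ℕ) : Matrix (Fin n) (Fin 2) ℝ := Matrix.of fun t => ![ePlus n t, eMinus n t]

/-- The five scenarios, each with its number `p` of auxiliary regressors and the matrix `Z` of
auxiliary regressors, so that `X̄ = (X, Z)`. -/
inductive Scenario {n k q : ℕ} (X : Matrix (Fin n) (Fin k) ℝ) (R : Matrix (Fin q) (Fin k) ℝ) :
    (p : ℕ) → Matrix (Fin n) (Fin p) ℝ → Prop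
  | one (hplus : ePlus n ∈ colSpan X) (hRplus : R *ᵥ ols X (ePlus n) = 0)
      (hminus : eMinus n ∉ colSpan X) (hn : k + 1 < n)
      (hdesign : DesignCondition (augX X (colMinus n)) (augR R 1)) :
      Scenario X R 1 (colMinus n)
  | two (hplus : ePlus n ∉ colSpan X) (hminus : eMinus n ∈ colSpan X)
      (hRminus : R *ᵥ ols X (eMinus n) = 0) (hn : k + 1 < n)
      (hdesign : DesignCondition (augX X (colPlus n)) (augR R 1)) :
      Scenario X R 1 (colPlus n)
  | three (hplus : ePlus n ∉ colSpan X) (hminus : eMinus n ∉ colSpan X)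
      (hrank : (augX X (colBoth n)).rank = k + 2) (hn : k + 2 < n)
      (hdesign : DesignCondition (augX X (colBoth n)) (augR R 2)) :
      Scenario X R 2 (colBoth n)
  | four (hplus : ePlus n ∉ colSpan X) (hminus : eMinus n ∉ colSpan X)
      (hrank : (augX X (colBoth n)).rank = k + 1) (hn : k + 1 < n)
      (hdesign : DesignCondition (augX X (colPlus n)) (augR R 1))
      (hRminus : augR R 1 *ᵥ ols (augX X (colPlus n)) (eMinus n) = 0) :
      Scenario X R 1 (colPlus n)
  | five (hplus : ePlus n ∉ colSpan X) (hminus : eMinus n ∉ colSpan X)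
      (hrank : (augX X (colBoth n)).rank = k + 1) (hn : k + 1 < n)
      (hdesign : DesignCondition (augX X (colMinus n)) (augR R 1))
      (hRplus : augR R 1 *ᵥ ols (augX X (colMinus n)) (ePlus n) = 0) :
      Scenario X R 1 (colMinus n)

/-- The possible matrices `Z` of auxiliary regressors: `e₋`, `e₊`, or both. -/
inductive AuxRegressors (n : ℕ) : (p : ℕ) → Matrix (Fin n) (Fin p) ℝ → Prop
  | minus : AuxRegressors n 1 (colMinus n)
  | plus : AuxRegressors n 1 (colPlus n)
  | both : AuxRegressors n 2 (colBoth n)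

end HAR

namespace HAR

open Matrix MeasureTheory ProbabilityTheory

/-! ### Gaussian densities and uniform domination of families of Gaussian laws -/

section Gaussian

open scoped RealInnerProductSpace ENNReal

set_option linter.unusedSectionVars false

variable {E : Type*} [NormedAddCommGroup E] [InnerProductSpace ℝ E] [FiniteDimensional ℝ E]
  [MeasurableSpace E] [BorelSpace E]

/-! Each scenario makes both `ePlus` and `eMinus` lie in the column space of the enlarged design,
with coefficient vectors annihilated by the enlarged restriction matrix (`Absorbed`,
`Scenario.spec`). The statistic is therefore unchanged when multiples of these vectors are added to
the data. These are exactly the directions onto which the AR(1) law concentrates as `ρ → ±1`.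

Write `ρ = ζ a` with `ζ = ±1` and `0 ≤ a < 1`. The lower triangular factor of `Λ(ρ)` equals `√(1 -
a²)` times a matrix `arFactor`, plus a rank-one matrix whose columns are multiples of `(ζ^t)`
(`arChol_eq`). Invariance removes the rank-one part, and homogeneity moves the scale `σ √(1 - ρ²)`
into a shift `η = (Rβ - r) / (σ √(1 - ρ²))` of the estimated restriction. Each rejection probability
thus becomes the probability of a shifted region `pivotSet` under the law of `arFactor` times a
standard Gaussian vector (`exists_mem_arLaws`). Now `arFactor` is continuous with determinant one on
the compact set `{±1} × [0, 1]`, endpoint `a = 1` included. So all these laws lie below one finite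
measure that is absolutely continuous and above one measure that charges open sets
(`uniformlyEquivalent_gaussLaw`).

The conclusions follow from these two bounds. On the null hypothesis `η = 0`; the lower bound keeps
the region and its complement from having small probability, and the upper bound makes large
critical values rarely exceeded. For infimal power, the laws are symmetric and a shift cannot lower
the statistic at both `x` and `-x` (`le_pivot_or_le_pivot_neg`). For power near one, non-rejection
bounds `‖η‖` by a finite function of the data (`norm_le_of_pivot_lt`), which the upper bound makes
unlikely for large `‖η‖`. For `ρ` in a compact subinterval of `(-1, 1)` the unmodified factors
already form a compact nonsingular family, so no absorption is needed. -/

lemma integrable_exp_neg_mul_sq_norm {b : ℝ} (hb : 0 < b) :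
    Integrable (fun x : E => Real.exp (-b * ‖x‖ ^ 2)) := by
  have h := (GaussianFourier.integrable_cexp_neg_mul_sq_norm_add (V := E) (b := (b : ℂ))
    (by simpa using hb) 0 0).norm
  refine h.congr (Filter.Eventually.of_forall fun x => ?_)
  simp only [Complex.norm_exp, zero_mul, add_zero]
  norm_cast

/-- The Gaussian density on a finite-dimensional Euclidean space, up to normalization. -/
noncomputable def gaussDensity (E : Type*) [NormedAddCommGroup E] (K b : ℝ) (x : E) : ℝ≥0∞ :=
  ENNReal.ofReal (K * Real.exp (-b * ‖x‖ ^ 2))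

lemma measurable_gaussDensity (K b : ℝ) : Measurable (gaussDensity E K b) := by
  unfold gaussDensity
  fun_prop

lemma isFiniteMeasure_gaussDensity (K : ℝ) {b : ℝ} (hb : 0 < b) :
    IsFiniteMeasure ((volume : Measure E).withDensity (gaussDensity E K b)) :=
  isFiniteMeasure_withDensity_ofReal ((integrable_exp_neg_mul_sq_norm hb).const_mul K).2

-- The characteristic functions agree, by the Gaussian Fourier integral; `K` is the reciprocal of
-- the total mass of the unnormalized density.
variable (E) in
lemma stdGaussian_eq_withDensity : ∃ K : ℝ, 0 < K ∧
    stdGaussian E = (volume : Measure E).withDensity (gaussDensity E K (1 / 2)) := by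
  have hb : (0 : ℝ) < 1 / 2 := by norm_num
  have hI := GaussianFourier.integral_rexp_neg_mul_sq_norm (V := E) hb
  have hpos : 0 < ∫ v : E, Real.exp (-(1 / 2 : ℝ) * ‖v‖ ^ 2) := by
    rw [hI]; positivity
  refine ⟨(∫ v : E, Real.exp (-(1 / 2 : ℝ) * ‖v‖ ^ 2))⁻¹, inv_pos.2 hpos, ?_⟩
  set K := (∫ v : E, Real.exp (-(1 / 2 : ℝ) * ‖v‖ ^ 2))⁻¹ with hK
  have := isFiniteMeasure_gaussDensity (E := E) K hb
  apply Measure.ext_of_charFun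
  ext t
  rw [charFun_stdGaussian, charFun_apply]
  have hd : gaussDensity E K (1 / 2) = fun x =>
      ((Real.toNNReal (K * Real.exp (-(1 / 2) * ‖x‖ ^ 2)) : NNReal) : ℝ≥0∞) := rfl
  rw [hd, integral_withDensity_eq_integral_smul (by fun_prop)]
  have h1 : ∀ x : E, (Real.toNNReal (K * Real.exp (-(1 / 2) * ‖x‖ ^ 2))) •
      Complex.exp (⟪x, t⟫ * Complex.I) =
      (K : ℂ) * Complex.exp (-(1 / 2 : ℂ) * ‖x‖ ^ 2 + Complex.I * ⟪t, x⟫) := by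
    intro x
    rw [NNReal.smul_def, Real.coe_toNNReal _ (by positivity), Complex.real_smul, Complex.exp_add,
      real_inner_comm, mul_comm Complex.I]
    push_cast
    ring
  simp_rw [h1]
  rw [integral_const_mul, GaussianFourier.integral_cexp_neg_mul_sq_norm_add (by norm_num)]
  have h2 := GaussianFourier.integral_cexp_neg_mul_sq_norm (V := E) (b := (1 / 2 : ℂ))
    (by norm_num)
  have h3 : ∫ v : E, Complex.exp (-(1 / 2 : ℂ) * ‖v‖ ^ 2) =
      ((∫ v : E, Real.exp (-(1 / 2 : ℝ) * ‖v‖ ^ 2) : ℝ) : ℂ) := by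
    rw [← integral_complex_ofReal]
    congr 1
    ext v
    push_cast
    rfl
  rw [← h2, h3, hK, ← mul_assoc, Complex.ofReal_inv,
    inv_mul_cancel₀ (by exact_mod_cast hpos.ne'), one_mul]
  congr 1
  rw [Complex.I_sq]
  ring

/-- Change of variables: an invertible linear map sends Lebesgue measure to `|det|⁻¹` times itself,
so a pointwise comparison of densities along `f` becomes a comparison of measures. -/
lemma map_withDensity_le {p q : E → ℝ≥0∞} (hq : Measurable q) (f : E →L[ℝ] E)
    (hf : LinearMap.det (f : E →ₗ[ℝ] E) ≠ 0) (h : ∀ x, p x ≤ q (f x)) :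
    ((volume : Measure E).withDensity p).map f ≤
      ENNReal.ofReal |(LinearMap.det (f : E →ₗ[ℝ] E))⁻¹| • (volume : Measure E).withDensity q := by
  refine Measure.le_iff.2 fun S hS => ?_
  have hm : Measurable f := f.continuous.measurable
  rw [Measure.map_apply hm hS, withDensity_apply _ (hm hS), Measure.smul_apply,
    withDensity_apply _ hS, smul_eq_mul, ← smul_eq_mul, ← lintegral_smul_measure,
    ← Measure.restrict_smul, ← Measure.map_linearMap_addHaar_eq_smul_addHaar _ hf,
    ContinuousLinearMap.coe_coe, setLIntegral_map hS hq hm]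
  exact lintegral_mono h

lemma le_map_withDensity {p q : E → ℝ≥0∞} (hq : Measurable q) (f : E →L[ℝ] E)
    (hf : LinearMap.det (f : E →ₗ[ℝ] E) ≠ 0) (h : ∀ x, q (f x) ≤ p x) :
    ENNReal.ofReal |(LinearMap.det (f : E →ₗ[ℝ] E))⁻¹| • (volume : Measure E).withDensity q ≤
      ((volume : Measure E).withDensity p).map f := by
  refine Measure.le_iff.2 fun S hS => ?_
  have hm : Measurable f := f.continuous.measurable
  rw [Measure.map_apply hm hS, withDensity_apply _ (hm hS), Measure.smul_apply,
    withDensity_apply _ hS, smul_eq_mul, ← smul_eq_mul, ← lintegral_smul_measure,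
    ← Measure.restrict_smul, ← Measure.map_linearMap_addHaar_eq_smul_addHaar _ hf,
    ContinuousLinearMap.coe_coe, setLIntegral_map hS hq hm]
  exact lintegral_mono h

/-- A class of measures that is dominated from above by a finite measure without singular part and
from below by a measure that charges open sets. -/
structure UniformlyEquivalent (𝓛 : Set (Measure E)) : Prop where
  upper : ∃ ν : Measure E, IsFiniteMeasure ν ∧ ν ≪ volume ∧ ∀ P ∈ 𝓛, P ≤ ν
  lower : ∃ ν : Measure E, ν.IsOpenPosMeasure ∧ ∀ P ∈ 𝓛, ν ≤ P

/-- Two-sided norm bounds squeeze the density of the image law between Gaussian densities with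
exponents `b'² / 2` and `1 / (2 b'²)`, while the determinant bounds control the prefactors. -/
lemma uniformlyEquivalent_of_bounds {α : Type*} {S : Set α} {f : α → E →L[ℝ] E} {b d D : ℝ}
    (hd : 0 < d) (hD : 0 < D)
    (hup : ∀ a ∈ S, ∀ x, ‖f a x‖ ≤ b * ‖x‖) (hlow : ∀ a ∈ S, ∀ x, ‖x‖ ≤ b * ‖f a x‖)
    (hdet : ∀ a ∈ S, d ≤ |LinearMap.det (f a : E →ₗ[ℝ] E)|)
    (hdet' : ∀ a ∈ S, |LinearMap.det (f a : E →ₗ[ℝ] E)| ≤ D) :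
    UniformlyEquivalent ((fun a => (stdGaussian E).map (f a)) '' S) := by
  obtain ⟨K, hK, hγ⟩ := stdGaussian_eq_withDensity E
  set b' := |b| + 1
  have hb' : 0 < b' := by positivity
  have hbb : b ≤ b' := (le_abs_self b).trans (by simp [b'])
  have hne : ∀ a ∈ S, LinearMap.det (f a : E →ₗ[ℝ] E) ≠ 0 := fun a ha h => by
    have := hdet a ha
    rw [h, abs_zero] at this
    linarith
  constructor
  · have := isFiniteMeasure_gaussDensity (E := E) K (b := 1 / 2 / b' ^ 2) (by positivity)
    refine ⟨ENNReal.ofReal d⁻¹ • (volume : Measure E).withDensity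
      (gaussDensity E K (1 / 2 / b' ^ 2)), ?_, ?_, ?_⟩
    · exact Measure.smul_finite _ ENNReal.ofReal_ne_top
    · exact Measure.smul_absolutelyContinuous.trans (withDensity_absolutelyContinuous _ _)
    · rintro _ ⟨a, ha, rfl⟩
      simp only [hγ]
      refine (map_withDensity_le (measurable_gaussDensity K (1 / 2 / b' ^ 2)) _ (hne a ha)
        fun x => ?_).trans ?_
      · unfold gaussDensity
        have h1 : ‖f a x‖ ^ 2 ≤ b' ^ 2 * ‖x‖ ^ 2 := by
          rw [← mul_pow]
          have := hup a ha x
          gcongr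
          exact this.trans (by gcongr)
        have h2 : 1 / 2 / b' ^ 2 * ‖f a x‖ ^ 2 ≤ 1 / 2 * ‖x‖ ^ 2 := by
          rw [div_mul_eq_mul_div, div_le_iff₀ (by positivity)]
          nlinarith
        gcongr ENNReal.ofReal (K * Real.exp ?_)
        linarith
      · refine Measure.le_iff.2 fun s _ => ?_
        simp only [Measure.smul_apply, smul_eq_mul]
        gcongr
        rw [abs_inv]
        exact inv_anti₀ hd (hdet a ha)
  · refine ⟨ENNReal.ofReal D⁻¹ • (volume : Measure E).withDensity
      (gaussDensity E K (1 / 2 * b' ^ 2)), ?_, ?_⟩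
    · constructor
      intro U hU hne h0
      rw [Measure.smul_apply, smul_eq_mul, mul_eq_zero] at h0
      rcases h0 with h0 | h0
      · rw [ENNReal.ofReal_eq_zero] at h0
        exact absurd (inv_pos.2 hD) (not_lt.2 h0)
      · rw [withDensity_apply_eq_zero (measurable_gaussDensity _ _)] at h0
        have : {x | gaussDensity E K (1 / 2 * b' ^ 2) x ≠ 0} = Set.univ := by
          ext x
          simp only [gaussDensity, Set.mem_ofPred_eq, ne_eq, ENNReal.ofReal_eq_zero, not_le,
            Set.mem_univ, iff_true]
          positivity
        rw [this, Set.univ_inter] at h0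
        exact (hU.measure_pos volume hne).ne' h0
    · rintro _ ⟨a, ha, rfl⟩
      simp only [hγ]
      refine le_trans ?_ (le_map_withDensity (measurable_gaussDensity K (1 / 2 * b' ^ 2)) _
        (hne a ha) fun x => ?_)
      · refine Measure.le_iff.2 fun s _ => ?_
        simp only [Measure.smul_apply, smul_eq_mul]
        gcongr
        rw [abs_inv]
        exact inv_anti₀ (hd.trans_le (hdet a ha)) (hdet' a ha)
      · unfold gaussDensity
        have h1 : ‖x‖ ^ 2 ≤ b' ^ 2 * ‖f a x‖ ^ 2 := by
          rw [← mul_pow]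
          have := hlow a ha x
          gcongr
          exact this.trans (by gcongr)
        gcongr ENNReal.ofReal (K * Real.exp ?_)
        linarith

end Gaussian

/-! ### Linear images of the standard Gaussian law -/

section Matrices

variable {n : ℕ}

/-- The law of `M g` for a standard Gaussian vector `g`. -/
noncomputable def gaussLaw (M : Matrix (Fin n) (Fin n) ℝ) : Measure (EuclideanSpace ℝ (Fin n)) :=
  (stdGaussian (EuclideanSpace ℝ (Fin n))).map (toEuclideanCLM (𝕜 := ℝ) M)

instance (M : Matrix (Fin n) (Fin n) ℝ) : IsProbabilityMeasure (gaussLaw M) :=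
  Measure.isProbabilityMeasure_map (by fun_prop)

lemma gaussLaw_map_neg (M : Matrix (Fin n) (Fin n) ℝ) :
    (gaussLaw M).map (fun x => -x) = gaussLaw M := by
  have h := stdGaussian_map (LinearIsometryEquiv.neg ℝ (E := EuclideanSpace ℝ (Fin n)))
  unfold gaussLaw
  conv_rhs => rw [← h]
  rw [Measure.map_map (by fun_prop) (by fun_prop), Measure.map_map (by fun_prop) (by fun_prop)]
  congr 1
  ext x : 1
  simp

/-- Any factor `M` of the covariance represents the law, not just the symmetric square root; this
permits the triangular AR(1) factor. Both sides have the same characteristic function because `‖Mᵀ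
t‖² = t' M Mᵀ t`. -/
lemma multivariateGaussian_mul_transpose (μ : EuclideanSpace ℝ (Fin n))
    (M : Matrix (Fin n) (Fin n) ℝ) :
    multivariateGaussian μ (M * Mᵀ) =
      (stdGaussian (EuclideanSpace ℝ (Fin n))).map
        (fun x => μ + toEuclideanCLM (𝕜 := ℝ) M x) := by
  have hS : (M * Mᵀ).PosSemidef := by
    simpa using posSemidef_self_mul_conjTranspose M
  have h : (fun x => μ + toEuclideanCLM (𝕜 := ℝ) M x) =
    (fun x => μ + x) ∘ (toEuclideanCLM (𝕜 := ℝ) M) := rfl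
  have hp : IsProbabilityMeasure ((stdGaussian (EuclideanSpace ℝ (Fin n))).map
        (fun x => μ + toEuclideanCLM (𝕜 := ℝ) M x)) :=
    Measure.isProbabilityMeasure_map (by fun_prop)
  apply Measure.ext_of_charFun
  ext t
  rw [charFun_multivariateGaussian hS, h, ← Measure.map_map (by fun_prop) (by fun_prop),
    charFun_map_const_add, charFun_eq_charFunDual_toDualMap, charFunDual_map,
    charFunDual_stdGaussian, ← Complex.exp_add]
  have hn : ‖(InnerProductSpace.toDualMap ℝ (EuclideanSpace ℝ (Fin n)) t).comp
      (toEuclideanCLM (𝕜 := ℝ) M)‖ ^ 2 = t ⬝ᵥ (M * Mᵀ) *ᵥ t := by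
    have h1 : (InnerProductSpace.toDualMap ℝ (EuclideanSpace ℝ (Fin n)) t).comp
      (toEuclideanCLM (𝕜 := ℝ) M) =
        InnerProductSpace.toDualMap ℝ _ (WithLp.toLp 2 (Mᵀ *ᵥ t.ofLp)) := by
      ext x
      simp only [ContinuousLinearMap.comp_apply, InnerProductSpace.toDualMap_apply_apply,
        EuclideanSpace.inner_eq_star_dotProduct, star_trivial, ofLp_toEuclideanCLM]
      rw [dotProduct_comm, dotProduct_mulVec, mulVec_transpose, dotProduct_comm]
    rw [h1, LinearIsometry.norm_map, EuclideanSpace.real_norm_sq_eq, ← mulVec_mulVec,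
      dotProduct_mulVec, ← mulVec_transpose]
    simp [dotProduct, sq]
  rw [← Complex.ofReal_pow, hn]
  congr 1
  rw [real_inner_comm]
  ring

lemma exists_bound_toEuclideanCLM {α : Type*} [TopologicalSpace α] {S : Set α} (hS : IsCompact S)
    {M : α → Matrix (Fin n) (Fin n) ℝ} (hM : ContinuousOn M S) :
    ∃ b, ∀ a ∈ S, ∀ x, ‖toEuclideanCLM (𝕜 := ℝ) (M a) x‖ ≤ b * ‖x‖ := by
  have hc : Continuous fun A : Matrix (Fin n) (Fin n) ℝ =>
      ‖(toEuclideanCLM (n := Fin n) (𝕜 := ℝ)) A‖ :=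
    (LinearMap.continuous_of_finiteDimensional
      ((toEuclideanCLM (n := Fin n) (𝕜 := ℝ)).toAlgEquiv.toLinearMap)).norm
  obtain ⟨b, hb⟩ := hS.bddAbove_image (hc.comp_continuousOn hM)
  refine ⟨b, fun a ha x => ?_⟩
  refine (ContinuousLinearMap.le_opNorm _ _).trans ?_
  gcongr
  exact hb (Set.mem_image_of_mem _ ha)

lemma det_toEuclideanCLM (M : Matrix (Fin n) (Fin n) ℝ) :
    LinearMap.det (toEuclideanCLM (𝕜 := ℝ) M : EuclideanSpace ℝ (Fin n) →ₗ[ℝ] _) = M.det := by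
  rw [coe_toEuclideanCLM_eq_toEuclideanLin, toEuclideanLin_eq_toLin_orthonormal,
    LinearMap.det_toLin]

/-- Compactness bounds the norms of `M a` and of its inverse from above, and `|det (M a)|` from
above and away from zero. -/
lemma uniformlyEquivalent_gaussLaw {α : Type*} [TopologicalSpace α] {S : Set α}
    (hS : IsCompact S) {M : α → Matrix (Fin n) (Fin n) ℝ} (hM : ContinuousOn M S)
    (hdet : ∀ a ∈ S, (M a).det ≠ 0) :
    UniformlyEquivalent ((fun a => gaussLaw (M a)) '' S) := by
  have hcd : ContinuousOn (fun a => (M a).det) S :=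
    (Continuous.matrix_det continuous_id).comp_continuousOn hM
  have hci : ContinuousOn (fun a => (M a)⁻¹) S := by
    have : ContinuousOn (fun a => ((M a).det)⁻¹ • (M a).adjugate) S :=
      (hcd.inv₀ hdet).smul ((Continuous.matrix_adjugate continuous_id).comp_continuousOn hM)
    refine this.congr fun a _ => ?_
    rw [Matrix.inv_def, Ring.inverse_eq_inv']
  obtain ⟨b₁, hb₁⟩ := exists_bound_toEuclideanCLM hS hM
  obtain ⟨b₂, hb₂⟩ := exists_bound_toEuclideanCLM hS hci
  obtain ⟨D, hD⟩ := hS.bddAbove_image hcd.abs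
  obtain ⟨d, hd, hd'⟩ : ∃ d > 0, ∀ a ∈ S, d ≤ |(M a).det| := by
    rcases S.eq_empty_or_nonempty with rfl | hne
    · exact ⟨1, one_pos, by simp⟩
    · obtain ⟨a, ha, hmin⟩ := hS.exists_isMinOn hne hcd.abs
      exact ⟨|(M a).det|, abs_pos.2 (hdet a ha), fun a' ha' => hmin ha'⟩
  refine uniformlyEquivalent_of_bounds (b := max b₁ b₂) (D := max D 1) hd (by positivity)
    (fun a ha x => (hb₁ a ha x).trans (by gcongr; exact le_max_left _ _)) (fun a ha x => ?_)
    (fun a ha => ?_) (fun a ha => ?_)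
  · have h := hb₂ a ha (toEuclideanCLM (𝕜 := ℝ) (M a) x)
    rw [← ContinuousLinearMap.comp_apply, ← ContinuousLinearMap.mul_def, ← map_mul,
      nonsing_inv_mul _ (isUnit_iff_ne_zero.2 (hdet a ha)), map_one,
      one_apply_eq_self] at h
    exact h.trans (by gcongr; exact le_max_right _ _)
  · rw [det_toEuclideanCLM]; exact hd' a ha
  · rw [det_toEuclideanCLM]
    exact (hD (Set.mem_image_of_mem _ ha)).trans (le_max_left _ _)

end Matrices

/-! ### Full rank, solvability and column spaces -/

lemma isUnit_det_of_rank_eq_card {m : Type*} [Fintype m] [DecidableEq m] {M : Matrix m m ℝ}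
    (h : M.rank = Fintype.card m) : IsUnit M.det := by
  rw [← isUnit_iff_isUnit_det, ← mulVec_surjective_iff_isUnit]
  have : LinearMap.range M.mulVecLin = ⊤ :=
    Submodule.eq_top_of_finrank_eq (by rw [Module.finrank_fintype_fun_eq_card]; exact h)
  exact LinearMap.range_eq_top.1 this

lemma eq_zero_of_vecMul_eq_zero {m l : Type*} [Fintype m] [DecidableEq m] [Fintype l]
    {M : Matrix m l ℝ} (h : M.rank = Fintype.card m) {v : m → ℝ} (hv : v ᵥ* M = 0) : v = 0 := by
  have hu : IsUnit (M * Mᵀ).det :=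
    isUnit_det_of_rank_eq_card (by rw [rank_self_mul_transpose, h])
  have h1 : v ᵥ* (M * Mᵀ) = 0 := by rw [← vecMul_vecMul, hv, zero_vecMul]
  have := congrArg (fun z => z ᵥ* (M * Mᵀ)⁻¹) h1
  simpa [vecMul_vecMul, mul_nonsing_inv _ hu] using this

lemma exists_mulVec_eq_of_rank {m l : Type*} [Fintype m] [DecidableEq m] [Fintype l]
    {M : Matrix m l ℝ} (h : M.rank = Fintype.card m) (v : m → ℝ) : ∃ x, M *ᵥ x = v := by
  have hu : IsUnit (M * Mᵀ).det :=
    isUnit_det_of_rank_eq_card (by rw [rank_self_mul_transpose, h])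
  exact ⟨Mᵀ *ᵥ ((M * Mᵀ)⁻¹ *ᵥ v), by
    rw [mulVec_mulVec, mulVec_mulVec, mul_nonsing_inv _ hu, one_mulVec]⟩

lemma mem_colSpan_iff {n : ℕ} {ι : Type*} [Fintype ι] {A : Matrix (Fin n) ι ℝ}
    {v : Fin n → ℝ} : v ∈ colSpan A ↔ ∃ x, A *ᵥ x = v := by
  rw [colSpan, ← range_mulVecLin]
  exact LinearMap.mem_range

/-! ### Least squares and the covariance estimator -/

section Regression

variable {n q : ℕ} {ι : Type*} [Fintype ι] [DecidableEq ι]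
  {A : Matrix (Fin n) ι ℝ} {G : Matrix (Fin q) ι ℝ}

lemma ols_add (A : Matrix (Fin n) ι ℝ) (x y : Fin n → ℝ) :
    ols A (x + y) = ols A x + ols A y := mulVec_add _ _ _

lemma ols_smul (A : Matrix (Fin n) ι ℝ) (c : ℝ) (x : Fin n → ℝ) :
    ols A (c • x) = c • ols A x := mulVec_smul _ _ _

lemma ols_neg (A : Matrix (Fin n) ι ℝ) (x : Fin n → ℝ) : ols A (-x) = -ols A x :=
  mulVec_neg _ _

lemma ols_mulVec (hA : IsUnit (Aᵀ * A).det) (v : ι → ℝ) : ols A (A *ᵥ v) = v := by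
  rw [ols, mulVec_mulVec, Matrix.mul_assoc, nonsing_inv_mul _ hA, one_mulVec]

lemma continuous_ols (A : Matrix (Fin n) ι ℝ) : Continuous (ols A) :=
  continuous_const.matrix_mulVec continuous_id

lemma resid_smul (A : Matrix (Fin n) ι ℝ) (c : ℝ) (x : Fin n → ℝ) :
    resid A (c • x) = c • resid A x := by
  rw [resid, resid, ols_smul, mulVec_smul, smul_sub]

lemma resid_add_mulVec (hA : IsUnit (Aᵀ * A).det) (x : Fin n → ℝ) (v : ι → ℝ) :
    resid A (x + A *ᵥ v) = resid A x := by
  rw [resid, resid, ols_add, ols_mulVec hA, mulVec_add, add_sub_add_right_eq_sub]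

lemma resid_eq_mulVec (A : Matrix (Fin n) ι ℝ) (x : Fin n → ℝ) :
    resid A x = (1 - A * ((Aᵀ * A)⁻¹ * Aᵀ)) *ᵥ x := by
  rw [resid, ols, sub_mulVec, one_mulVec, mulVec_mulVec]

lemma continuous_resid (A : Matrix (Fin n) ι ℝ) : Continuous (resid A) :=
  continuous_id.sub (continuous_const.matrix_mulVec (continuous_ols A))

/-- The residual-maker matrix is symmetric, so its vanishing `i`-th row is also a vanishing `i`-th
column: the `i`-th basis vector has zero residual. -/
lemma single_mem_colSpan {i : Fin n} (h : ∀ x, resid A x i = 0) :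
    (Pi.single i 1 : Fin n → ℝ) ∈ colSpan A := by
  set N := 1 - A * ((Aᵀ * A)⁻¹ * Aᵀ) with hN
  have hsymm : Nᵀ = N := by
    rw [hN]
    simp only [transpose_sub, transpose_one, transpose_mul, transpose_transpose,
      transpose_nonsing_inv, Matrix.mul_assoc]
  have hrow : ∀ j, N i j = 0 := fun j => by
    have := h (Pi.single j 1)
    rwa [resid_eq_mulVec, ← hN, mulVec_single_one, col_apply] at this
  have h0 : resid A (Pi.single i 1) = 0 := by
    ext j
    rw [resid_eq_mulVec, ← hN, mulVec_single_one, col_apply, ← hsymm, transpose_apply, hrow]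
    rfl
  rw [resid, sub_eq_zero] at h0
  exact mem_colSpan_iff.2 ⟨_, h0.symm⟩

/-- The Toeplitz matrix of the weights. -/
def weightMatrix (n : ℕ) (w : ℤ → ℝ) : Matrix (Fin n) (Fin n) ℝ :=
  Matrix.of fun i j : Fin n => w ((i : ℤ) - (j : ℤ))

/-- Transposition exchanges `t` and `s`, which merges the two signs of the lag into one formula. -/
lemma autocov_eq (A : Matrix (Fin n) ι ℝ) (y : Fin n → ℝ) (j : ℤ) :
    autocov A y j = (n : ℝ)⁻¹ • ∑ t : Fin n, ∑ s : Fin n,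
      if ((t : ℤ) - (s : ℤ)) = j then vecMulVec (score A y t) (score A y s) else 0 := by
  unfold autocov autocovNat
  split_ifs with hj
  · congr! 6 with t _ s _
    omega
  · rw [transpose_smul, transpose_sum]
    congr 1
    simp_rw [transpose_sum]
    rw [Finset.sum_comm]
    congr! 2 with t _ s _
    split_ifs with h1 h2 h2
    · exact transpose_vecMulVec _ _
    · omega
    · omega
    · exact transpose_zero

lemma psi_eq (w : ℤ → ℝ) (A : Matrix (Fin n) ι ℝ) (y : Fin n → ℝ) :
    psi w A y = (n : ℝ)⁻¹ •
      ((Matrix.of (score A y))ᵀ * weightMatrix n w * Matrix.of (score A y)) := by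
  have h1 : psi w A y = (n : ℝ)⁻¹ • ∑ t : Fin n, ∑ s : Fin n,
      w ((t : ℤ) - s) • vecMulVec (score A y t) (score A y s) := by
    unfold psi
    simp_rw [autocov_eq, smul_comm (w _) (n : ℝ)⁻¹, ← Finset.smul_sum, Finset.smul_sum (r := w _)]
    congr 1
    rw [Finset.sum_comm]
    refine Finset.sum_congr rfl fun t _ => ?_
    rw [Finset.sum_comm]
    refine Finset.sum_congr rfl fun s _ => ?_
    rw [Finset.sum_eq_single ((t : ℤ) - s)]
    · simp
    · intro j _ hj
      rw [if_neg hj.symm, smul_zero]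
    · intro h
      exact absurd (Finset.mem_Icc.2 ⟨by omega, by omega⟩) h
  rw [h1]
  congr 1
  ext a b
  simp only [Matrix.sum_apply, Matrix.smul_apply, vecMulVec_apply, smul_eq_mul, mul_apply,
    transpose_apply, of_apply, weightMatrix, Finset.sum_mul]
  rw [Finset.sum_comm]
  refine Finset.sum_congr rfl fun t _ => Finset.sum_congr rfl fun s _ => ?_
  ring

/-- The matrix `G (A'A)⁻¹ A'`, which maps the data to the estimate of `G β`. -/
noncomputable def hat (A : Matrix (Fin n) ι ℝ) (G : Matrix (Fin q) ι ℝ) :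
    Matrix (Fin q) (Fin n) ℝ :=
  G * (Aᵀ * A)⁻¹ * Aᵀ

lemma hat_mulVec (y : Fin n → ℝ) : hat A G *ᵥ y = G *ᵥ ols A y := by
  rw [hat, ols, mulVec_mulVec, Matrix.mul_assoc]

/-- The matrix `G (A'A)⁻¹ A' diag(û(y))`. -/
noncomputable def hatScore (A : Matrix (Fin n) ι ℝ) (G : Matrix (Fin q) ι ℝ) (y : Fin n → ℝ) :
    Matrix (Fin q) (Fin n) ℝ :=
  hat A G * diagonal (resid A y)

/-- The sandwich form with the weight matrix in the middle shows semidefiniteness, continuity and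
quadratic homogeneity at once. -/
lemma omega_eq (w : ℤ → ℝ) (A : Matrix (Fin n) ι ℝ) (G : Matrix (Fin q) ι ℝ) (y : Fin n → ℝ) :
    omega w A G y = hatScore A G y * weightMatrix n w * (hatScore A G y)ᵀ := by
  -- The factors `n` and `n⁻¹` cancel only for `n ≠ 0`; for `n = 0` both sides vanish.
  rcases Nat.eq_zero_or_pos n with rfl | hn
  · ext a b
    simp [omega, mul_apply]
  have hs : Matrix.of (score A y) = diagonal (resid A y) * A := by
    ext t a
    simp [score]
  rw [omega, psi_eq, hs, hatScore, hat]
  simp only [Matrix.mul_smul, Matrix.smul_mul, smul_smul, transpose_mul, transpose_transpose,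
    diagonal_transpose, transpose_nonsing_inv]
  rw [mul_inv_cancel₀ (by positivity), one_smul]
  simp only [Matrix.mul_assoc]

lemma hatScore_smul (c : ℝ) (y : Fin n → ℝ) : hatScore A G (c • y) = c • hatScore A G y := by
  rw [hatScore, resid_smul, diagonal_smul, Matrix.mul_smul, hatScore]

lemma omega_smul (w : ℤ → ℝ) (c : ℝ) (y : Fin n → ℝ) :
    omega w A G (c • y) = c ^ 2 • omega w A G y := by
  simp only [omega_eq, hatScore_smul, transpose_smul, Matrix.smul_mul, Matrix.mul_smul, smul_smul,
    sq]

lemma omega_neg (w : ℤ → ℝ) (y : Fin n → ℝ) : omega w A G (-y) = omega w A G y := by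
  rw [← neg_one_smul ℝ y, omega_smul]
  simp

lemma omega_add_mulVec (w : ℤ → ℝ) (hA : IsUnit (Aᵀ * A).det) (y : Fin n → ℝ) (v : ι → ℝ) :
    omega w A G (y + A *ᵥ v) = omega w A G y := by
  simp only [omega_eq, hatScore, resid_add_mulVec hA]

lemma continuous_omega (w : ℤ → ℝ) (A : Matrix (Fin n) ι ℝ) (G : Matrix (Fin q) ι ℝ) :
    Continuous (omega w A G) := by
  have h : Continuous (hatScore A G) :=
    continuous_const.matrix_mul (continuous_resid A).matrix_diagonal
  rw [show omega w A G = _ from funext (omega_eq w A G)]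
  exact (h.matrix_mul continuous_const).matrix_mul h.matrix_transpose

lemma posSemidef_omega {w : ℤ → ℝ} (hw : WeightCondition n w) (y : Fin n → ℝ) :
    (omega w A G y).PosSemidef := by
  rw [omega_eq, ← conjTranspose_eq_transpose_of_trivial]
  exact hw.posDef.posSemidef.mul_mul_conjTranspose_same _

/-- It suffices that `hatScore` has trivial left kernel. In every column kept by the design
condition the residual is nonzero and can be cancelled, leaving a left kernel vector of a matrix of
rank `q`. -/
lemma posDef_omega {w : ℤ → ℝ} (hw : WeightCondition n w) (hD : DesignCondition A G)
    {y : Fin n → ℝ}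
    (hy : ∀ i, (Pi.single i 1 : Fin n → ℝ) ∉ colSpan A → resid A y i ≠ 0) :
    (omega w A G y).PosDef := by
  rw [omega_eq, ← conjTranspose_eq_transpose_of_trivial]
  refine hw.posDef.mul_mul_conjTranspose_same ?_
  suffices ∀ v, v ᵥ* hatScore A G y = 0 → v = 0 by
    intro a b hab
    exact sub_eq_zero.1 (this _ (by rw [sub_vecMul, sub_eq_zero]; exact hab))
  intro v hv
  classical
  refine eq_zero_of_vecMul_eq_zero (hD.trans (Fintype.card_fin q).symm) ?_
  ext ⟨i, hi⟩
  have h1 := congrFun hv i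
  rw [hatScore, ← vecMul_vecMul, vecMul_diagonal, Pi.zero_apply, mul_eq_zero] at h1
  exact h1.resolve_right (hy i hi)

/-- The exceptional points lie in finitely many kernels of nonzero linear functionals, each of
Lebesgue measure zero. -/
lemma ae_posDef_omega {w : ℤ → ℝ} (hw : WeightCondition n w) (hD : DesignCondition A G) :
    ∀ᵐ x : EuclideanSpace ℝ (Fin n), (omega w A G x.ofLp).PosDef := by
  have h : ∀ i, (Pi.single i 1 : Fin n → ℝ) ∉ colSpan A →
      ∀ᵐ x : EuclideanSpace ℝ (Fin n), resid A x.ofLp i ≠ 0 := by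
    intro i hi
    let f : EuclideanSpace ℝ (Fin n) →ₗ[ℝ] ℝ :=
      LinearMap.proj i ∘ₗ (1 - A * ((Aᵀ * A)⁻¹ * Aᵀ)).mulVecLin ∘ₗ
        (WithLp.linearEquiv 2 ℝ (Fin n → ℝ)).toLinearMap
    have hf : ∀ x, f x = resid A x.ofLp i := fun x => by
      rw [resid_eq_mulVec]; rfl
    have hne : LinearMap.ker f ≠ ⊤ := fun htop => hi <| single_mem_colSpan fun x => by
      have : WithLp.toLp 2 x ∈ LinearMap.ker f := htop ▸ Submodule.mem_top
      rwa [LinearMap.mem_ker, hf] at this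
    have h0 := Measure.addHaar_submodule (volume : Measure (EuclideanSpace ℝ (Fin n))) _ hne
    rw [ae_iff]
    convert h0 using 2
    ext x
    simp [hf]
  have h2 : ∀ᵐ x : EuclideanSpace ℝ (Fin n), ∀ i,
      (Pi.single i 1 : Fin n → ℝ) ∉ colSpan A → resid A x.ofLp i ≠ 0 := by
    rw [ae_all_iff]
    intro i
    by_cases hi : (Pi.single i 1 : Fin n → ℝ) ∈ colSpan A
    · exact Filter.Eventually.of_forall fun _ h => absurd hi h
    · filter_upwards [h i hi] with x hx _ using hx
  filter_upwards [h2] with x hx using posDef_omega hw hD hx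

/-! ### The shifted statistic: invariance, regularity and bounds -/

open Classical in
/-- The test statistic with shift `η`: the studentized quadratic form in `G β̂(x) + η`. -/
noncomputable def pivot (w : ℤ → ℝ) (A : Matrix (Fin n) ι ℝ) (G : Matrix (Fin q) ι ℝ)
    (η : Fin q → ℝ) (x : Fin n → ℝ) : ℝ :=
  if (omega w A G x).det ≠ 0 then
    (G *ᵥ ols A x + η) ⬝ᵥ ((omega w A G x)⁻¹ *ᵥ (G *ᵥ ols A x + η))
  else 0

/-- Numerator and covariance estimator are both quadratic in the scale once the shift is scaled
along with the data. -/
lemma pivot_smul (w : ℤ → ℝ) (η : Fin q → ℝ) {c : ℝ} (hc : c ≠ 0) (x : Fin n → ℝ) :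
    pivot w A G (c • η) (c • x) = pivot w A G η x := by
  have hdet : (omega w A G (c • x)).det ≠ 0 ↔ (omega w A G x).det ≠ 0 := by
    rw [omega_smul, det_smul]
    simp [hc]
  unfold pivot
  rw [ols_smul, mulVec_smul, ← smul_add]
  split_ifs with h1 h2 h2
  · rw [omega_smul, show c ^ 2 • omega w A G x = (Units.mk0 (c ^ 2) (pow_ne_zero 2 hc)) •
      omega w A G x from rfl, inv_smul' _ _ (isUnit_iff_ne_zero.2 h2), Units.smul_def, smul_mulVec,
      mulVec_smul, smul_dotProduct, dotProduct_smul, dotProduct_smul]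
    simp only [Units.val_inv_eq_inv_val, Units.val_mk0, smul_eq_mul]
    field_simp
  · exact absurd (hdet.1 h1) h2
  · exact absurd (hdet.2 h2) h1
  · rfl

lemma pivot_add_mulVec (w : ℤ → ℝ) (hA : IsUnit (Aᵀ * A).det) (η : Fin q → ℝ) (x : Fin n → ℝ)
    (v : ι → ℝ) : pivot w A G η (x + A *ᵥ v) = pivot w A G (G *ᵥ v + η) x := by
  simp only [pivot, omega_add_mulVec w hA, ols_add, ols_mulVec hA, mulVec_add, add_assoc]

lemma measurable_pivot (w : ℤ → ℝ) (A : Matrix (Fin n) ι ℝ) (G : Matrix (Fin q) ι ℝ)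
    (η : Fin q → ℝ) : Measurable (pivot w A G η) := by
  have hdet : Continuous fun x => (omega w A G x).det := (continuous_omega w A G).matrix_det
  have hv : Continuous fun x => G *ᵥ ols A x + η :=
    (continuous_const.matrix_mulVec (continuous_ols A)).add continuous_const
  refine Measurable.ite (hdet.measurable (measurableSet_singleton 0).compl) ?_ measurable_const
  have : (fun x => (G *ᵥ ols A x + η) ⬝ᵥ ((omega w A G x)⁻¹ *ᵥ (G *ᵥ ols A x + η))) =
      fun x => ((omega w A G x).det)⁻¹ *
        ((G *ᵥ ols A x + η) ⬝ᵥ ((omega w A G x).adjugate *ᵥ (G *ᵥ ols A x + η))) := by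
    ext x
    rw [Matrix.inv_def, Ring.inverse_eq_inv', smul_mulVec, dotProduct_smul, smul_eq_mul]
  rw [this]
  exact hdet.measurable.inv.mul
    (hv.dotProduct ((continuous_omega w A G).matrix_adjugate.matrix_mulVec hv)).measurable

lemma continuousOn_pivot (w : ℤ → ℝ) (A : Matrix (Fin n) ι ℝ) (G : Matrix (Fin q) ι ℝ)
    (η : Fin q → ℝ) : ContinuousOn (pivot w A G η) {x | (omega w A G x).det ≠ 0} := by
  have hdet : Continuous fun x => (omega w A G x).det := (continuous_omega w A G).matrix_det
  have hv : Continuous fun x => G *ᵥ ols A x + η :=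
    (continuous_const.matrix_mulVec (continuous_ols A)).add continuous_const
  have h1 : ContinuousOn (fun x => ((omega w A G x).det)⁻¹ *
        ((G *ᵥ ols A x + η) ⬝ᵥ ((omega w A G x).adjugate *ᵥ (G *ᵥ ols A x + η))))
      {x | (omega w A G x).det ≠ 0} :=
    (hdet.continuousOn.inv₀ fun x hx => hx).mul
      (hv.dotProduct ((continuous_omega w A G).matrix_adjugate.matrix_mulVec hv)).continuousOn
  refine h1.congr fun x hx => ?_
  rw [pivot, if_pos (show (omega w A G x).det ≠ 0 from hx), Matrix.inv_def, Ring.inverse_eq_inv', smul_mulVec, dotProduct_smul,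
    smul_eq_mul]

/-- Reflecting the data, the shifted statistic is at least the unshifted one. -/
lemma le_pivot_or_le_pivot_neg {w : ℤ → ℝ} (hw : WeightCondition n w) {C : ℝ} (hC : 0 < C)
    (η : Fin q → ℝ) {x : Fin n → ℝ} (h : C ≤ pivot w A G 0 x) :
    C ≤ pivot w A G η x ∨ C ≤ pivot w A G η (-x) := by
  have hdet : (omega w A G x).det ≠ 0 := fun h0 => by
    rw [pivot, if_neg (not_not.2 h0)] at h
    linarith
  have hQ := (posSemidef_omega (A := A) (G := G) hw x).inv.dotProduct_mulVec_nonneg η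
  rw [star_trivial] at hQ
  rw [pivot, if_pos hdet, add_zero] at h
  rw [pivot, pivot, omega_neg, if_pos hdet, if_pos hdet, ols_neg, mulVec_neg]
  set Q := (omega w A G x)⁻¹
  set u := G *ᵥ ols A x
  -- Parallelogram argument: the values at `x` and `-x` add up to `2 u'Qu + 2 η'Qη`, which is at
  -- least `2C`, so they cannot both be below `C`.
  by_contra! hlt
  obtain ⟨h1, h2⟩ := hlt
  simp only [mulVec_add, mulVec_neg, add_dotProduct, dotProduct_add, neg_dotProduct,
    dotProduct_neg] at h1 h2
  linarith

/-- The entry sum `s` bounds the quadratic form of `Q` by `s` times the squared length. Expanding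
the nonnegative form of `Q` at `v - s Q⁻¹ v` turns this into the bound for `Q⁻¹`, without
eigenvalues. -/
lemma PosDef.dotProduct_self_le {Q : Matrix (Fin q) (Fin q) ℝ} (hQ : Q.PosDef)
    (v : Fin q → ℝ) : v ⬝ᵥ v ≤ (∑ i, ∑ j, |Q i j|) * (v ⬝ᵥ (Q⁻¹ *ᵥ v)) := by
  by_cases hv : v = 0
  · simp [hv]
  set s := ∑ i, ∑ j, |Q i j| with hs
  set x := Q⁻¹ *ᵥ v with hx
  have hu : IsUnit Q.det := hQ.det_pos.ne'.isUnit
  have hQx : Q *ᵥ x = v := by rw [hx, mulVec_mulVec, mul_nonsing_inv _ hu, one_mulVec]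
  have hvpos : 0 < v ⬝ᵥ v := by
    have : 0 ≤ v ⬝ᵥ v := by simpa using dotProduct_star_self_nonneg v
    exact lt_of_le_of_ne this fun h => hv (dotProduct_self_eq_zero.1 h.symm)
  have hle : v ⬝ᵥ (Q *ᵥ v) ≤ s * (v ⬝ᵥ v) := by
    have hentry : ∀ i j, |v i * v j| ≤ v ⬝ᵥ v := fun i j => by
      have h1 : ∀ i, v i ^ 2 ≤ v ⬝ᵥ v := fun i => by
        rw [sq]
        exact Finset.single_le_sum (f := fun i => v i * v i) (fun _ _ => mul_self_nonneg _)
          (Finset.mem_univ i)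
      rw [abs_le]
      constructor <;> nlinarith [h1 i, h1 j, sq_nonneg (v i + v j), sq_nonneg (v i - v j)]
    rw [hs, Finset.sum_mul]
    refine Finset.sum_le_sum fun i _ => ?_
    rw [mulVec, dotProduct, Finset.mul_sum, Finset.sum_mul]
    refine Finset.sum_le_sum fun j _ => ?_
    calc v i * (Q i j * v j) ≤ |v i * (Q i j * v j)| := le_abs_self _
      _ = |Q i j| * |v i * v j| := by rw [← abs_mul]; ring_nf
      _ ≤ |Q i j| * (v ⬝ᵥ v) := by gcongr; exact hentry i j
  have hspos : 0 < s := by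
    have := hQ.dotProduct_mulVec_pos hv
    rw [star_trivial] at this
    by_contra! h
    nlinarith
  have hsq := hQ.posSemidef.dotProduct_mulVec_nonneg (v - s • x)
  have hcross : x ⬝ᵥ (Q *ᵥ v) = v ⬝ᵥ v := by
    have hT : Qᵀ = Q := hQ.isHermitian
    rw [dotProduct_mulVec, ← mulVec_transpose, hT, hQx]
  rw [star_trivial, mulVec_sub, mulVec_smul, hQx, sub_dotProduct, dotProduct_sub, dotProduct_sub,
    smul_dotProduct, smul_dotProduct, hcross, dotProduct_smul, dotProduct_smul,
    dotProduct_comm x v] at hsq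
  simp only [smul_eq_mul] at hsq
  have : s * (v ⬝ᵥ v) ≤ s * (s * (v ⬝ᵥ x)) := by linarith
  exact le_of_mul_le_mul_left this hspos

/-- A bound for the shift in terms of the data on the event that the statistic is small. -/
lemma norm_le_of_pivot_lt {w : ℤ → ℝ} {C : ℝ} {η : Fin q → ℝ}
    {x : Fin n → ℝ} (hx : (omega w A G x).PosDef) (h : pivot w A G η x < C) :
    ‖η‖ ≤ √((∑ i, ∑ j, |omega w A G x i j|) * C) + ‖G *ᵥ ols A x‖ := by
  have hdet : (omega w A G x).det ≠ 0 := hx.det_pos.ne'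
  rw [pivot, if_pos hdet] at h
  set v := G *ᵥ ols A x + η with hv
  have h1 : ‖v‖ ≤ √((∑ i, ∑ j, |omega w A G x i j|) * C) := by
    refine Real.le_sqrt_of_sq_le ?_
    have h2 : ‖v‖ ^ 2 ≤ v ⬝ᵥ v := by
      have h3 : ‖v‖ ≤ √(v ⬝ᵥ v) := by
        refine (pi_norm_le_iff_of_nonneg (Real.sqrt_nonneg _)).2 fun i => ?_
        rw [Real.norm_eq_abs]
        refine Real.abs_le_sqrt ?_
        rw [sq]
        exact Finset.single_le_sum (f := fun i => v i * v i) (fun _ _ => mul_self_nonneg _)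
          (Finset.mem_univ i)
      have h4 : 0 ≤ v ⬝ᵥ v := by simpa using dotProduct_star_self_nonneg v
      calc ‖v‖ ^ 2 ≤ √(v ⬝ᵥ v) ^ 2 := by gcongr
        _ = v ⬝ᵥ v := Real.sq_sqrt h4
    refine h2.trans ((PosDef.dotProduct_self_le hx v).trans ?_)
    gcongr
  have h2 : η = v - G *ᵥ ols A x := by rw [hv, add_sub_cancel_left]
  rw [h2]
  exact (norm_sub_le _ _).trans (by gcongr)

/-- Adding elements of the column space moves the statistic anywhere. -/
lemma exists_pivot_pos {w : ℤ → ℝ} (hw : WeightCondition n w) (hq : 1 ≤ q)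
    (hA : IsUnit (Aᵀ * A).det) (hG : G.rank = q) (hD : DesignCondition A G) {C : ℝ}
    (hC : 0 < C) :
    (∃ x, (omega w A G x).det ≠ 0 ∧ pivot w A G 0 x < C) ∧
    ∃ x, (omega w A G x).det ≠ 0 ∧ C < pivot w A G 0 x := by
  obtain ⟨y, hy⟩ := (ae_posDef_omega hw hD).exists
  set z := y.ofLp
  -- Moving `z` within the column space leaves the covariance estimator fixed, while the full row
  -- rank of `G` lets the estimate of the restriction take any value `η`.
  have key : ∀ η : Fin q → ℝ, ∃ x, (omega w A G x).det ≠ 0 ∧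
      pivot w A G 0 x = η ⬝ᵥ ((omega w A G z)⁻¹ *ᵥ η) := fun η => by
    obtain ⟨v, hv⟩ := exists_mulVec_eq_of_rank (hG.trans (Fintype.card_fin q).symm)
      (η - G *ᵥ ols A z)
    refine ⟨z + A *ᵥ v, ?_, ?_⟩
    · rw [omega_add_mulVec w hA]; exact hy.det_pos.ne'
    · rw [pivot_add_mulVec w hA, pivot, if_pos hy.det_pos.ne', hv, add_zero, add_sub_cancel]
  constructor
  · obtain ⟨x, hx, hx'⟩ := key 0
    exact ⟨x, hx, by rw [hx']; simpa using hC⟩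
  · set e : Fin q → ℝ := Pi.single ⟨0, hq⟩ 1 with he
    have hne : e ≠ 0 := by simp [he]
    have hpos := hy.inv.dotProduct_mulVec_pos hne
    rw [star_trivial] at hpos
    set a := e ⬝ᵥ ((omega w A G z)⁻¹ *ᵥ e)
    -- The scaling makes the value of the quadratic form exactly `C + 1`.
    obtain ⟨x, hx, hx'⟩ := key ((√((C + 1) / a)) • e)
    refine ⟨x, hx, ?_⟩
    rw [hx', mulVec_smul, smul_dotProduct, dotProduct_smul, smul_eq_mul, smul_eq_mul, ← mul_assoc,
      Real.mul_self_sqrt (by positivity), div_mul_cancel₀ _ hpos.ne']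
    linarith

end Regression

/-! ### Factorization of the AR(1) correlation matrix -/

section AR

/-- The Cholesky factor of the AR(1) correlation matrix, as a function of natural indices. -/
noncomputable def arCoeff (ρ : ℝ) (t s : ℕ) : ℝ :=
  if s ≤ t then (if s = 0 then ρ ^ t else √(1 - ρ ^ 2) * ρ ^ (t - s)) else 0

lemma arCoeff_add (ρ : ℝ) {t s : ℕ} (d : ℕ) (h : s ≤ t) :
    arCoeff ρ (t + d) s = ρ ^ d * arCoeff ρ t s := by
  unfold arCoeff
  rw [if_pos h, if_pos (by omega)]
  split_ifs
  · ring
  · rw [show t + d - s = (t - s) + d by omega]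
    ring

/-- Unit variance of the stationary recursion: row `t + 1` is `ρ` times row `t` plus a new entry
`√(1 - ρ²)`, and `ρ² + (1 - ρ²) = 1`. -/
lemma sum_arCoeff_sq {ρ : ℝ} (h : ρ ∈ Set.Ioo (-1 : ℝ) 1) (t : ℕ) :
    ∑ s ∈ Finset.range (t + 1), arCoeff ρ t s * arCoeff ρ t s = 1 := by
  have hρ : 0 ≤ 1 - ρ ^ 2 := by nlinarith [h.1, h.2]
  induction t with
  | zero => simp [arCoeff]
  | succ t ih =>
    rw [Finset.sum_range_succ]
    have h1 : ∀ s ∈ Finset.range (t + 1), arCoeff ρ (t + 1) s * arCoeff ρ (t + 1) s =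
        ρ ^ 2 * (arCoeff ρ t s * arCoeff ρ t s) := fun s hs => by
      rw [arCoeff_add ρ 1 (by have := Finset.mem_range.1 hs; omega)]
      ring
    rw [Finset.sum_congr rfl h1, ← Finset.mul_sum, ih]
    simp only [arCoeff, le_refl, if_true, Nat.add_eq_zero_iff, one_ne_zero, and_false, if_false,
      Nat.sub_self, pow_zero, mul_one]
    rw [Real.mul_self_sqrt hρ]
    ring

lemma sum_arCoeff_mul {ρ : ℝ} (h : ρ ∈ Set.Ioo (-1 : ℝ) 1) {n t : ℕ} (ht : t < n) (d : ℕ) :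
    ∑ s ∈ Finset.range n, arCoeff ρ t s * arCoeff ρ (t + d) s = ρ ^ d := by
  have hsub : Finset.range (t + 1) ⊆ Finset.range n := Finset.range_subset_range.2 ht
  rw [← Finset.sum_subset hsub]
  · have h1 : ∀ s ∈ Finset.range (t + 1), arCoeff ρ t s * arCoeff ρ (t + d) s =
        ρ ^ d * (arCoeff ρ t s * arCoeff ρ t s) := fun s hs => by
      rw [arCoeff_add ρ d (by have := Finset.mem_range.1 hs; omega)]
      ring
    rw [Finset.sum_congr rfl h1, ← Finset.mul_sum, sum_arCoeff_sq h, mul_one]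
  · intro s _ hs
    have : ¬ s ≤ t := fun h => hs (Finset.mem_range.2 (by omega))
    rw [arCoeff, if_neg this, zero_mul]

/-- The lower triangular factor of the AR(1) correlation matrix. -/
noncomputable def arChol (n : ℕ) (ρ : ℝ) : Matrix (Fin n) (Fin n) ℝ :=
  Matrix.of fun t s => arCoeff ρ t s

lemma arChol_mul_transpose (n : ℕ) {ρ : ℝ} (h : ρ ∈ Set.Ioo (-1 : ℝ) 1) :
    arChol n ρ * (arChol n ρ)ᵀ = ar1Corr n ρ := by
  ext t u
  simp only [arChol, ar1Corr, mul_apply, transpose_apply, of_apply]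
  rw [Fin.sum_univ_eq_sum_range (fun s => arCoeff ρ t s * arCoeff ρ u s) n]
  rcases le_total (t : ℕ) u with htu | htu
  · obtain ⟨d, hd⟩ := Nat.exists_eq_add_of_le htu
    rw [hd, sum_arCoeff_mul h t.2]
    congr 1
    omega
  · obtain ⟨d, hd⟩ := Nat.exists_eq_add_of_le htu
    simp_rw [mul_comm (arCoeff ρ t _)]
    rw [hd, sum_arCoeff_mul h u.2]
    congr 1
    omega

lemma isLowerTriangular_of_natIndex {n : ℕ} {F : ℕ → ℕ → ℝ} (h : ∀ t s, t < s → F t s = 0) :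
    (Matrix.of fun t s : Fin n => F t s).IsLowerTriangular := by
  intro i j hij
  exact h _ _ hij

lemma det_arChol_ne_zero (n : ℕ) {ρ : ℝ} (h : ρ ∈ Set.Ioo (-1 : ℝ) 1) :
    (arChol n ρ).det ≠ 0 := by
  have hρ : 0 < 1 - ρ ^ 2 := by nlinarith [h.1, h.2]
  rw [arChol, det_of_isLowerTriangular _
    (isLowerTriangular_of_natIndex fun t s hts => by rw [arCoeff, if_neg (by omega)])]
  refine Finset.prod_ne_zero_iff.2 fun i _ => ?_
  rw [of_apply, arCoeff, if_pos le_rfl]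
  split_ifs with h0
  · simp [h0]
  · rw [Nat.sub_self, pow_zero, mul_one]
    positivity

lemma continuous_arChol (n : ℕ) : Continuous (arChol n) := by
  refine continuous_matrix fun t s => ?_
  simp only [arChol, of_apply, arCoeff]
  split_ifs <;> fun_prop

/-- The AR(1) factor after division by `√(1 - a²)`, where `ρ = ζ a` with `ζ = ±1`, corrected in its
first column by a multiple of `(ζ ^ t)` such that it stays regular as `a → 1`. -/
noncomputable def arFactor (n : ℕ) (p : ℝ × ℝ) : Matrix (Fin n) (Fin n) ℝ :=
  Matrix.of fun t s : Fin n =>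
    if (s : ℕ) ≤ t then
      (if (s : ℕ) = 0 then
        p.1 ^ (t : ℕ) * (1 - (∑ i ∈ Finset.range t, p.2 ^ i) * √((1 - p.2) / (1 + p.2)))
      else (p.1 * p.2) ^ ((t : ℕ) - s))
    else 0

/-- The parameter set `{±1} × [0, 1]` of `arFactor`. -/
def arParam : Set (ℝ × ℝ) := {1, -1} ×ˢ Set.Icc 0 1

lemma isCompact_arParam : IsCompact arParam :=
  ((Set.toFinite ({1, -1} : Set ℝ)).isCompact).prod isCompact_Icc

lemma continuousOn_arFactor (n : ℕ) : ContinuousOn (arFactor n) arParam := by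
  refine continuousOn_pi.2 fun t => continuousOn_pi.2 fun s => ?_
  simp only [arFactor, of_apply]
  split_ifs
  · have h : ContinuousOn (fun p : ℝ × ℝ => √((1 - p.2) / (1 + p.2))) arParam := by
      refine ContinuousOn.sqrt (ContinuousOn.div (by fun_prop) (by fun_prop) fun p hp => ?_)
      have := hp.2.1
      linarith
    fun_prop
  · fun_prop
  · fun_prop

lemma det_arFactor (n : ℕ) (p : ℝ × ℝ) : (arFactor n p).det = 1 := by
  rw [arFactor, det_of_isLowerTriangular]
  · refine Finset.prod_eq_one fun i _ => ?_
    rw [of_apply, if_pos le_rfl]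
    split_ifs with h0
    · simp [h0]
    · simp
  · intro i j hij
    have : ¬ (j : ℕ) ≤ i := not_le.2 hij
    rw [of_apply, if_neg this]

/-- Only the first column needs correction. Subtracting `(1 - √(1 - a²)) ζ^t` leaves a multiple of
`√(1 - a²)`, because `1 - a^t = (1 - a) ∑ a^i` and `1 - a = √(1 - a²) √((1 - a) / (1 + a))`. Using
the coefficient `1 - √(1 - a²)` instead of `1` keeps the top diagonal entry of `arFactor` equal to
one. -/
lemma arChol_eq (n : ℕ) {ζ a : ℝ} (hζ : ζ = 1 ∨ ζ = -1) (ha : a ∈ Set.Ico (0 : ℝ) 1) :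
    arChol n (ζ * a) = √(1 - a ^ 2) • arFactor n (ζ, a) +
      (1 - √(1 - a ^ 2)) • vecMulVec (fun t : Fin n => ζ ^ (t : ℕ))
        (fun s : Fin n => if (s : ℕ) = 0 then 1 else 0) := by
  have hζ2 : ζ ^ 2 = 1 := by rcases hζ with rfl | rfl <;> norm_num
  have hc : (ζ * a) ^ 2 = a ^ 2 := by rw [mul_pow, hζ2, one_mul]
  ext t s
  simp only [arChol, arFactor, arCoeff, of_apply, Matrix.add_apply, Matrix.smul_apply,
    smul_eq_mul, vecMulVec_apply, hc]
  have h1 : 0 ≤ 1 - a := by linarith [ha.2]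
  have h2 : 0 < 1 + a := by linarith [ha.1]
  have hs : √(1 - a ^ 2) * √((1 - a) / (1 + a)) = 1 - a := by
    rw [← Real.sqrt_mul (by nlinarith [ha.1, ha.2]),
      show (1 - a ^ 2) * ((1 - a) / (1 + a)) = (1 - a) ^ 2 by field_simp; ring,
      Real.sqrt_sq h1]
  have hg : (1 - a) * ∑ i ∈ Finset.range t, a ^ i = 1 - a ^ (t : ℕ) := mul_neg_geom_sum a t
  split_ifs with h3 h4 h4
  · rw [mul_pow]
    have : √(1 - a ^ 2) * (ζ ^ (t : ℕ) *
        (1 - (∑ i ∈ Finset.range t, a ^ i) * √((1 - a) / (1 + a)))) =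
        ζ ^ (t : ℕ) * (√(1 - a ^ 2) - (√(1 - a ^ 2) * √((1 - a) / (1 + a))) *
          ∑ i ∈ Finset.range t, a ^ i) := by ring
    rw [this, hs, hg]
    ring
  · ring
  · omega
  · ring

end AR

/-! ### Rejection probabilities uniformly over a dominated family -/

section Laws

open scoped ENNReal

/-- Continuity from above: the superlevel sets of a real-valued function decrease to the empty set.
-/
lemma exists_measure_ge_le {α : Type*} [MeasurableSpace α] (ν : Measure α) [IsFiniteMeasure ν]
    {φ : α → ℝ} (hφ : Measurable φ) {ε : ℝ≥0∞} (hε : 0 < ε) :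
    ∃ K : ℕ, ν {x | (K : ℝ) ≤ φ x} ≤ ε := by
  have h := tendsto_measure_iInter_atTop (μ := ν) (s := fun K : ℕ => {x | (K : ℝ) ≤ φ x})
    (fun K => (measurableSet_le measurable_const hφ).nullMeasurableSet)
    (fun K L hKL x (hx : (L : ℝ) ≤ φ x) =>
      show (K : ℝ) ≤ φ x from le_trans (Nat.cast_le.2 hKL) hx) ⟨0, measure_ne_top _ _⟩
  have h0 : ⋂ K : ℕ, {x | (K : ℝ) ≤ φ x} = ∅ := by
    refine Set.eq_empty_of_forall_notMem fun x hx => ?_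
    obtain ⟨K, hK⟩ := exists_nat_gt (φ x)
    exact absurd (Set.mem_iInter.1 hx K) (not_le.2 hK)
  rw [h0, measure_empty] at h
  exact ((h.eventually (gt_mem_nhds hε)).exists).imp fun _ h => h.le

variable {n q : ℕ} {ι : Type*} [Fintype ι] [DecidableEq ι]
  {A : Matrix (Fin n) ι ℝ} {G : Matrix (Fin q) ι ℝ} {w : ℤ → ℝ}

/-- The rejection region of the shifted test statistic. -/
def pivotSet (w : ℤ → ℝ) (A : Matrix (Fin n) ι ℝ) (G : Matrix (Fin q) ι ℝ) (η : Fin q → ℝ)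
    (C : ℝ) : Set (EuclideanSpace ℝ (Fin n)) :=
  {x | C ≤ pivot w A G η x.ofLp}

lemma measurableSet_pivotSet (w : ℤ → ℝ) (A : Matrix (Fin n) ι ℝ) (G : Matrix (Fin q) ι ℝ)
    (η : Fin q → ℝ) (C : ℝ) : MeasurableSet (pivotSet w A G η C) :=
  measurableSet_le measurable_const
    ((measurable_pivot w A G η).comp (WithLp.measurable_ofLp 2 _))

/-- The statistic is continuous where the covariance estimator is nonsingular and takes values on
both sides of `C` there. Hence the region and its complement each contain a nonempty open set, which
the minorizing measure charges. -/
lemma exists_pos_le_measure_pivotSet (hw : WeightCondition n w) (hq : 1 ≤ q)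
    (hA : IsUnit (Aᵀ * A).det) (hG : G.rank = q) (hD : DesignCondition A G) {C : ℝ}
    (hC : 0 < C) {𝓛 : Set (Measure (EuclideanSpace ℝ (Fin n)))} (h𝓛 : UniformlyEquivalent 𝓛) :
    ∃ c : ℝ≥0∞, 0 < c ∧ ∀ P ∈ 𝓛, c ≤ P (pivotSet w A G 0 C) ∧ c ≤ P (pivotSet w A G 0 C)ᶜ := by
  obtain ⟨ν, hν, hle⟩ := h𝓛.lower
  obtain ⟨⟨x, hx, hxC⟩, ⟨y, hy, hyC⟩⟩ := exists_pivot_pos hw hq hA hG hD hC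
  have hopen : IsOpen {x | (omega w A G x).det ≠ 0} :=
    isOpen_ne_fun (continuous_omega w A G).matrix_det continuous_const
  have hpos : ∀ U : Set ℝ, IsOpen U → ∀ z, (omega w A G z).det ≠ 0 → pivot w A G 0 z ∈ U →
      0 < ν {x | pivot w A G 0 x.ofLp ∈ U} := fun U hU z hz hzU => by
    have ho : IsOpen (WithLp.ofLp ⁻¹' ({x | (omega w A G x).det ≠ 0} ∩ pivot w A G 0 ⁻¹' U) :
        Set (EuclideanSpace ℝ (Fin n))) :=
      ((continuousOn_pivot w A G 0).isOpen_inter_preimage hopen hU).preimage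
        (PiLp.continuous_ofLp 2 _)
    exact (ho.measure_pos ν ⟨WithLp.toLp 2 z, hz, hzU⟩).trans_le
      (measure_mono fun x hx => hx.2)
  refine ⟨min (ν (pivotSet w A G 0 C)) (ν (pivotSet w A G 0 C)ᶜ), lt_min ?_ ?_, fun P hP =>
    ⟨(min_le_left _ _).trans (hle P hP _), (min_le_right _ _).trans (hle P hP _)⟩⟩
  · exact (hpos (Set.Ioi C) isOpen_Ioi y hy hyC).trans_le (measure_mono fun x hx =>
      show C ≤ pivot w A G 0 x.ofLp from le_of_lt hx)
  · exact (hpos (Set.Iio C) isOpen_Iio x hx hxC).trans_le (measure_mono fun x hx =>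
      show ¬ C ≤ pivot w A G 0 x.ofLp from not_le.2 hx)

lemma measure_pivotSet_zero_le (hw : WeightCondition n w) {C : ℝ} (hC : 0 < C) (η : Fin q → ℝ)
    {P : Measure (EuclideanSpace ℝ (Fin n))} (hP : P.map (fun x => -x) = P) :
    P (pivotSet w A G 0 C) ≤ 2 * P (pivotSet w A G η C) := by
  have h1 : P ((fun x => -x) ⁻¹' pivotSet w A G η C) = P (pivotSet w A G η C) := by
    rw [← Measure.map_apply (by fun_prop) (measurableSet_pivotSet w A G η C), hP]
  calc P (pivotSet w A G 0 C) ≤ P (pivotSet w A G η C ∪ (fun x => -x) ⁻¹' pivotSet w A G η C) :=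
        measure_mono fun x hx => le_pivot_or_le_pivot_neg hw hC η hx
    _ ≤ _ := measure_union_le _ _
    _ = _ := by rw [h1, two_mul]

/-- Almost surely, non-rejection forces `‖η‖` below a continuous function of the data that does not
involve `η`; the tail of that function is small under the dominating finite measure. -/
lemma exists_measure_compl_pivotSet_le (hw : WeightCondition n w) (hD : DesignCondition A G)
    (C : ℝ) {𝓛 : Set (Measure (EuclideanSpace ℝ (Fin n)))} (h𝓛 : UniformlyEquivalent 𝓛)
    {ε : ℝ≥0∞} (hε : 0 < ε) :
    ∃ K : ℝ, ∀ η : Fin q → ℝ, K ≤ ‖η‖ → ∀ P ∈ 𝓛, P (pivotSet w A G η C)ᶜ ≤ ε := by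
  obtain ⟨ν, hν, hac, hle⟩ := h𝓛.upper
  have hφ : Measurable fun x : EuclideanSpace ℝ (Fin n) =>
      √((∑ i, ∑ j, |omega w A G x.ofLp i j|) * C) + ‖G *ᵥ ols A x.ofLp‖ := by
    have h1 := (continuous_omega w A G).comp (PiLp.continuous_ofLp 2 (fun _ : Fin n => ℝ))
    have h2 := (continuous_const (y := G)).matrix_mulVec
      ((continuous_ols A).comp (PiLp.continuous_ofLp 2 (fun _ : Fin n => ℝ)))
    have h3 : ∀ i j, Continuous fun x : EuclideanSpace ℝ (Fin n) => omega w A G x.ofLp i j :=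
      fun i j => h1.matrix_elem i j
    refine Continuous.measurable (Continuous.add (Continuous.sqrt ?_) h2.norm)
    fun_prop
  obtain ⟨K, hK⟩ := exists_measure_ge_le ν hφ hε
  refine ⟨K, fun η hη P hP => (hle P hP _).trans (le_trans ?_ hK)⟩
  refine measure_mono_ae ?_
  filter_upwards [hac.ae_le (ae_posDef_omega hw hD)] with x hx hxs
  exact hη.trans (norm_le_of_pivot_lt hx (not_le.1 hxs))

lemma exists_measure_pivotSet_le {𝓛 : Set (Measure (EuclideanSpace ℝ (Fin n)))}
    (w : ℤ → ℝ) (A : Matrix (Fin n) ι ℝ) (G : Matrix (Fin q) ι ℝ) (h𝓛 : UniformlyEquivalent 𝓛)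
    {ε : ℝ≥0∞} (hε : 0 < ε) :
    ∃ C : ℝ, 0 < C ∧ ∀ P ∈ 𝓛, P (pivotSet w A G 0 C) ≤ ε := by
  obtain ⟨ν, hν, hac, hle⟩ := h𝓛.upper
  obtain ⟨K, hK⟩ := exists_measure_ge_le ν
    ((measurable_pivot w A G 0).comp (WithLp.measurable_ofLp 2 _)) hε
  -- The tail level `K` may be zero; adding one makes the critical value positive.
  refine ⟨K + 1, by positivity, fun P hP => (hle P hP _).trans (le_trans (measure_mono ?_) hK)⟩
  intro x hx
  exact le_trans (by simp) (show (K + 1 : ℝ) ≤ _ from hx)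

end Laws

/-! ### From the scenarios to absorbed directions -/

section Design

variable {n k q p : ℕ} {X : Matrix (Fin n) (Fin k) ℝ} {R : Matrix (Fin q) (Fin k) ℝ}

lemma mulVec_eq_zero_iff_of_rank {m l : Type*} [Fintype l] [DecidableEq l] [Fintype m]
    {M : Matrix m l ℝ} (h : M.rank = Fintype.card l) {v : l → ℝ} (hv : M *ᵥ v = 0) : v = 0 :=
  eq_zero_of_vecMul_eq_zero (M := Mᵀ) (by rw [rank_transpose, h]) (by rwa [vecMul_transpose])

lemma rank_eq_card_of_mulVec {m l : Type*} [Fintype l] [Fintype m]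
    {M : Matrix m l ℝ} (h : ∀ v, M *ᵥ v = 0 → v = 0) : M.rank = Fintype.card l := by
  rw [Matrix.rank, LinearMap.finrank_range_of_inj, Module.finrank_fintype_fun_eq_card]
  rw [← LinearMap.ker_eq_bot, LinearMap.ker_eq_bot']
  exact h

lemma isUnit_gram {m l : Type*} [Fintype l] [DecidableEq l] [Fintype m]
    {M : Matrix m l ℝ} (h : M.rank = Fintype.card l) : IsUnit (Mᵀ * M).det :=
  isUnit_det_of_rank_eq_card (by rw [rank_transpose_mul_self, h])

lemma augX_mulVec (Z : Matrix (Fin n) (Fin p) ℝ) (β : Fin k → ℝ) (γ : Fin p → ℝ) :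
    augX X Z *ᵥ Sum.elim β γ = X *ᵥ β + Z *ᵥ γ := by
  rw [augX, fromCols_mulVec]
  rfl

lemma augR_mulVec (β : Fin k → ℝ) (γ : Fin p → ℝ) :
    augR R p *ᵥ Sum.elim β γ = R *ᵥ β := by
  rw [augR, fromCols_mulVec, zero_mulVec, add_zero]
  rfl

lemma rank_augR (hR : R.rank = q) (p : ℕ) : (augR R p).rank = q := by
  refine le_antisymm ((rank_le_card_height (augR R p)).trans (Fintype.card_fin q).le) ?_
  have h : R = augR R p * fromRows (1 : Matrix (Fin k) (Fin k) ℝ) (0 : Matrix (Fin p) (Fin k) ℝ) := by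
    rw [augR, fromCols_mul_fromRows]
    simp
  calc q = (augR R p * fromRows (1 : Matrix (Fin k) (Fin k) ℝ)
        (0 : Matrix (Fin p) (Fin k) ℝ)).rank := by rw [← h, hR]
    _ ≤ (augR R p).rank := rank_mul_le_left _ _

lemma rank_augX_col (hX : X.rank = k) {Z : Matrix (Fin n) (Fin 1) ℝ} {z : Fin n → ℝ}
    (hZ : ∀ t, Z t 0 = z t) (hz : z ∉ colSpan X) : (augX X Z).rank = k + 1 := by
  rw [rank_eq_card_of_mulVec]
  · simp
  intro v hv
  obtain ⟨β, γ, rfl⟩ : ∃ β γ, v = Sum.elim β γ := ⟨v ∘ Sum.inl, v ∘ Sum.inr, by simp⟩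
  rw [augX_mulVec] at hv
  have hZγ : Z *ᵥ γ = γ 0 • z := by
    ext t
    simp [mulVec, dotProduct, hZ, mul_comm]
  rw [hZγ] at hv
  have hγ : γ 0 = 0 := by
    by_contra h
    refine hz (mem_colSpan_iff.2 ⟨-((γ 0)⁻¹ • β), ?_⟩)
    rw [mulVec_neg, mulVec_smul, eq_neg_of_add_eq_zero_left hv, smul_neg, neg_neg, smul_smul,
      inv_mul_cancel₀ h, one_smul]
  rw [hγ, zero_smul, add_zero] at hv
  have hβ : β = 0 := mulVec_eq_zero_iff_of_rank (by rw [hX, Fintype.card_fin]) hv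
  ext i
  rcases i with i | i
  · simp [hβ]
  · rw [Fin.fin_one_eq_zero i]
    simpa using hγ

lemma colPlus_mulVec (γ : Fin 1 → ℝ) : colPlus n *ᵥ γ = γ 0 • ePlus n := by
  ext t
  simp [mulVec, dotProduct, colPlus, mul_comm]

lemma colMinus_mulVec (γ : Fin 1 → ℝ) : colMinus n *ᵥ γ = γ 0 • eMinus n := by
  ext t
  simp [mulVec, dotProduct, colMinus, mul_comm]

lemma colBoth_mulVec (γ : Fin 2 → ℝ) :
    colBoth n *ᵥ γ = γ 0 • ePlus n + γ 1 • eMinus n := by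
  ext t
  simp [mulVec, dotProduct, colBoth, mul_comm]

/-- Used in scenarios four and five: when one auxiliary regressor already attains the rank of the
design with both, the omitted one is in its column space. -/
lemma mem_colSpan_of_rank_eq {l : Type*} [Fintype l] {A : Matrix (Fin n) l ℝ}
    {Z : Matrix (Fin n) (Fin 2) ℝ} (h : A.rank = (augX X Z).rank)
    (hle : colSpan A ≤ colSpan (augX X Z)) {z : Fin n → ℝ} (hz : z ∈ colSpan (augX X Z)) :
    z ∈ colSpan A := by
  have : colSpan A = colSpan (augX X Z) := by
    refine Submodule.eq_of_le_of_finrank_eq hle ?_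
    rw [colSpan, colSpan, ← rank_eq_finrank_span_cols, ← rank_eq_finrank_span_cols, h]
  rwa [this]

/-- `z` is a regressor (or a combination of regressors) whose coefficients the hypothesis does
not restrict. -/
def Absorbed (X : Matrix (Fin n) (Fin k) ℝ) (R : Matrix (Fin q) (Fin k) ℝ)
    (Z : Matrix (Fin n) (Fin p) ℝ) (z : Fin n → ℝ) : Prop :=
  ∃ v, augX X Z *ᵥ v = z ∧ augR R p *ᵥ v = 0

lemma absorbed_of_aux {Z : Matrix (Fin n) (Fin p) ℝ} {z : Fin n → ℝ} (γ : Fin p → ℝ)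
    (h : Z *ᵥ γ = z) : Absorbed X R Z z :=
  ⟨Sum.elim 0 γ, by rw [augX_mulVec, mulVec_zero, zero_add, h], by rw [augR_mulVec, mulVec_zero]⟩

lemma absorbed_of_mem (hX : X.rank = k) {Z : Matrix (Fin n) (Fin p) ℝ} {z : Fin n → ℝ}
    (hz : z ∈ colSpan X) (h : R *ᵥ ols X z = 0) : Absorbed X R Z z := by
  obtain ⟨β, rfl⟩ := mem_colSpan_iff.1 hz
  rw [ols_mulVec (isUnit_gram (by rw [hX, Fintype.card_fin]))] at h
  exact ⟨Sum.elim β 0, by rw [augX_mulVec, mulVec_zero, add_zero], by rw [augR_mulVec, h]⟩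

lemma absorbed_of_mem_augX {Z : Matrix (Fin n) (Fin p) ℝ} {z : Fin n → ℝ}
    (hA : (augX X Z).rank = k + p) (hz : z ∈ colSpan (augX X Z))
    (h : augR R p *ᵥ ols (augX X Z) z = 0) : Absorbed X R Z z := by
  obtain ⟨v, rfl⟩ := mem_colSpan_iff.1 hz
  rw [ols_mulVec (isUnit_gram (by simpa using hA))] at h
  exact ⟨v, rfl, h⟩

/-- These four consequences are all that the main argument takes from a scenario. -/
lemma Scenario.spec (hX : X.rank = k) {Z : Matrix (Fin n) (Fin p) ℝ} (h : Scenario X R p Z) :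
    (augX X Z).rank = k + p ∧ DesignCondition (augX X Z) (augR R p) ∧
      Absorbed X R Z (ePlus n) ∧ Absorbed X R Z (eMinus n) := by
  have hp : Absorbed X R (colPlus n) (ePlus n) :=
    absorbed_of_aux (fun _ => 1) (by simp [colPlus_mulVec])
  have hm : Absorbed X R (colMinus n) (eMinus n) :=
    absorbed_of_aux (fun _ => 1) (by simp [colMinus_mulVec])
  cases h with
  | one hplus hRplus hminus hn hdesign =>
    exact ⟨rank_augX_col hX (fun t => by simp [colMinus]) hminus, hdesign,
      absorbed_of_mem hX hplus hRplus, hm⟩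
  | two hplus hminus hRminus hn hdesign =>
    exact ⟨rank_augX_col hX (fun t => by simp [colPlus]) hplus, hdesign,
      hp, absorbed_of_mem hX hminus hRminus⟩
  | three hplus hminus hrank hn hdesign =>
    exact ⟨hrank, hdesign, absorbed_of_aux ![1, 0] (by simp [colBoth_mulVec]),
      absorbed_of_aux ![0, 1] (by simp [colBoth_mulVec])⟩
  | four hplus hminus hrank hn hdesign hRminus =>
    have hA := rank_augX_col hX (Z := colPlus n) (fun t => by simp [colPlus]) hplus
    refine ⟨hA, hdesign, hp, absorbed_of_mem_augX hA
      (mem_colSpan_of_rank_eq (hA.trans hrank.symm) (fun z hz => ?_) ?_) hRminus⟩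
    · obtain ⟨v, rfl⟩ := mem_colSpan_iff.1 hz
      obtain ⟨β, γ, rfl⟩ : ∃ β γ, v = Sum.elim β γ := ⟨v ∘ Sum.inl, v ∘ Sum.inr, by simp⟩
      refine mem_colSpan_iff.2 ⟨Sum.elim β ![γ 0, 0], ?_⟩
      simp [colBoth_mulVec, colPlus_mulVec]
    · exact mem_colSpan_iff.2 ⟨Sum.elim 0 ![0, 1], by simp [colBoth_mulVec]⟩
  | five hplus hminus hrank hn hdesign hRplus =>
    have hA := rank_augX_col hX (Z := colMinus n) (fun t => by simp [colMinus]) hminus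
    refine ⟨hA, hdesign, absorbed_of_mem_augX hA
      (mem_colSpan_of_rank_eq (hA.trans hrank.symm) (fun z hz => ?_) ?_) hRplus, hm⟩
    · obtain ⟨v, rfl⟩ := mem_colSpan_iff.1 hz
      obtain ⟨β, γ, rfl⟩ : ∃ β γ, v = Sum.elim β γ := ⟨v ∘ Sum.inl, v ∘ Sum.inr, by simp⟩
      refine mem_colSpan_iff.2 ⟨Sum.elim β ![0, γ 0], ?_⟩
      simp [colBoth_mulVec, colMinus_mulVec]
    · exact mem_colSpan_iff.2 ⟨Sum.elim 0 ![1, 0], by simp [colBoth_mulVec]⟩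

lemma Absorbed.pow {Z : Matrix (Fin n) (Fin p) ℝ} (hplus : Absorbed X R Z (ePlus n))
    (hminus : Absorbed X R Z (eMinus n)) {ζ : ℝ} (hζ : ζ = 1 ∨ ζ = -1) :
    Absorbed X R Z (fun t : Fin n => ζ ^ (t : ℕ)) := by
  rcases hζ with rfl | rfl
  · have h : (fun t : Fin n => (1 : ℝ) ^ (t : ℕ)) = ePlus n := by
      ext t
      simp [ePlus]
    rwa [h]
  · obtain ⟨v, hv, hv'⟩ := hminus
    refine ⟨-v, ?_, by rw [mulVec_neg, hv', neg_zero]⟩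
    rw [mulVec_neg, hv]
    ext t
    -- Indices start at zero, so `(-1)^t` is the negative of `eMinus`; hence the coefficient vector
    -- `-v`.
    simp [eMinus, pow_succ]

end Design

/-! ### Reduction of rejection probabilities to the regularized laws -/

section Reduction

variable {n k q p : ℕ} {X : Matrix (Fin n) (Fin k) ℝ} {R : Matrix (Fin q) (Fin k) ℝ}
  {Z : Matrix (Fin n) (Fin p) ℝ} {r : Fin q → ℝ} {w : ℤ → ℝ}

lemma TBar_eq_pivot (y : Fin n → ℝ) :
    TBar w X Z R r y = pivot w (augX X Z) (augR R p) (-r) y := by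
  have h : R *ᵥ betaBar X Z y = augR R p *ᵥ ols (augX X Z) y := by
    rw [betaBar, mulVec_mulVec, mul_fromCols, Matrix.mul_one, Matrix.mul_zero]
  rw [TBar, pivot, h, sub_eq_add_neg]
  rfl

/-- The absorbed direction drops out, the mean enters only through `Rβ - r`, and the scale `c` is
transferred to the shift. -/
lemma TBar_add (hA : (augX X Z).rank = k + p) {β : Fin k → ℝ} {c : ℝ} (hc : c ≠ 0)
    (x : Fin n → ℝ) {z : Fin n → ℝ} (hz : Absorbed X R Z z) (a : ℝ) :
    TBar w X Z R r (X *ᵥ β + (c • x + a • z)) =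
      pivot w (augX X Z) (augR R p) (c⁻¹ • (R *ᵥ β - r)) x := by
  have hu : IsUnit ((augX X Z)ᵀ * augX X Z).det := isUnit_gram (by simpa using hA)
  obtain ⟨v, rfl, hv⟩ := hz
  have h : X *ᵥ β + (c • x + a • augX X Z *ᵥ v) =
      c • x + augX X Z *ᵥ (Sum.elim β 0 + a • v) := by
    rw [mulVec_add, augX_mulVec, mulVec_zero, add_zero, mulVec_smul]
    abel
  rw [TBar_eq_pivot, h, pivot_add_mulVec w hu, mulVec_add, augR_mulVec, mulVec_smul, hv, smul_zero,
    add_zero, ← sub_eq_add_neg,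
    ← pivot_smul w (c⁻¹ • (R *ᵥ β - r)) hc x, smul_inv_smul₀ hc]

lemma absorbed_zero : Absorbed X R Z 0 := ⟨0, mulVec_zero _, mulVec_zero _⟩

lemma measurableSet_WBar (C : ℝ) : MeasurableSet (WBar w X Z R r C) := by
  have h : WBar w X Z R r C = pivotSet w (augX X Z) (augR R p) (-r) C := by
    unfold WBar pivotSet
    simp only [TBar_eq_pivot]
  rw [h]
  exact measurableSet_pivotSet _ _ _ _ _

lemma prob_eq_stdGaussian (μ : EuclideanSpace ℝ (Fin n)) {σ2 ρ : ℝ} (hσ : 0 < σ2)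
    (hρ : ρ ∈ Set.Ioo (-1 : ℝ) 1) {W : Set (EuclideanSpace ℝ (Fin n))} (hW : MeasurableSet W) :
    prob μ σ2 ρ W = stdGaussian (EuclideanSpace ℝ (Fin n))
      {g | μ + √σ2 • toEuclideanCLM (𝕜 := ℝ) (arChol n ρ) g ∈ W} := by
  have h : σ2 • ar1Corr n ρ = (√σ2 • arChol n ρ) * (√σ2 • arChol n ρ)ᵀ := by
    rw [transpose_smul, Matrix.smul_mul, Matrix.mul_smul, smul_smul, Real.mul_self_sqrt hσ.le,
      arChol_mul_transpose n hρ]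
  rw [prob, h, multivariateGaussian_mul_transpose, Measure.map_apply (by fun_prop) hW, map_smul]
  rfl

/-- The rank-one part of the factor contributes a random multiple of the absorbed vector `z`, to
which the statistic is blind. -/
lemma prob_eq_gaussLaw_of_eq (hA : (augX X Z).rank = k + p) {μ : EuclideanSpace ℝ (Fin n)}
    {β : Fin k → ℝ} (hμ : μ.ofLp = X *ᵥ β) {σ2 ρ s : ℝ} (hσ : 0 < σ2) (hs : 0 < s)
    (hρ : ρ ∈ Set.Ioo (-1 : ℝ) 1) {B : Matrix (Fin n) (Fin n) ℝ} {z u : Fin n → ℝ} {a : ℝ}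
    (hz : Absorbed X R Z z) (hB : arChol n ρ = s • B + a • vecMulVec z u) (C : ℝ) :
    prob μ σ2 ρ (WBar w X Z R r C) = gaussLaw B
      (pivotSet w (augX X Z) (augR R p) ((√σ2 * s)⁻¹ • (R *ᵥ β - r)) C) := by
  rw [prob_eq_stdGaussian μ hσ hρ (measurableSet_WBar C), gaussLaw,
    Measure.map_apply (by fun_prop) (measurableSet_pivotSet _ _ _ _ _)]
  refine congrArg _ (Set.ext fun g => ?_)
  have hc : √σ2 * s ≠ 0 := by positivity
  have h : (μ + √σ2 • toEuclideanCLM (𝕜 := ℝ) (arChol n ρ) g).ofLp =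
      X *ᵥ β + ((√σ2 * s) • (B *ᵥ g.ofLp) + (√σ2 * a * (u ⬝ᵥ g.ofLp)) • z) := by
    rw [WithLp.ofLp_add, hμ, WithLp.ofLp_smul, ofLp_toEuclideanCLM, hB, add_mulVec, smul_mulVec,
      smul_mulVec, vecMulVec_mulVec, op_smul_eq_smul, smul_add, smul_smul, smul_smul, smul_smul,
      mul_assoc]
  change C ≤ TBar w X Z R r _ ↔ C ≤ pivot w _ _ _ _
  rw [h, TBar_add hA hc _ hz, ofLp_toEuclideanCLM]

/-- The case of a zero rank-one part; it requires nothing of `ePlus` and `eMinus`. -/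
lemma prob_eq_gaussLaw_arChol (hA : (augX X Z).rank = k + p) {μ : EuclideanSpace ℝ (Fin n)}
    {β : Fin k → ℝ} (hμ : μ.ofLp = X *ᵥ β) {σ2 ρ : ℝ} (hσ : 0 < σ2)
    (hρ : ρ ∈ Set.Ioo (-1 : ℝ) 1) (C : ℝ) :
    prob μ σ2 ρ (WBar w X Z R r C) = gaussLaw (arChol n ρ)
      (pivotSet w (augX X Z) (augR R p) ((√σ2)⁻¹ • (R *ᵥ β - r)) C) := by
  rw [prob_eq_gaussLaw_of_eq hA hμ hσ one_pos hρ absorbed_zero (u := 0) (a := 0)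
    (by rw [one_smul, zero_smul, add_zero]), mul_one]

/-- The laws of `B g`, with `B` running through the regularized AR(1) factors. -/
noncomputable def arLaws (n : ℕ) : Set (Measure (EuclideanSpace ℝ (Fin n))) :=
  (fun a => gaussLaw (arFactor n a)) '' arParam

lemma uniformlyEquivalent_arLaws (n : ℕ) : UniformlyEquivalent (arLaws n) :=
  uniformlyEquivalent_gaussLaw isCompact_arParam (continuousOn_arFactor n)
    fun a _ => by rw [det_arFactor]; exact one_ne_zero

lemma exists_mem_arLaws (hA : (augX X Z).rank = k + p) (hplus : Absorbed X R Z (ePlus n))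
    (hminus : Absorbed X R Z (eMinus n)) (w : ℤ → ℝ) (r : Fin q → ℝ) {ρ : ℝ}
    (hρ : ρ ∈ Set.Ioo (-1 : ℝ) 1) :
    ∃ P ∈ arLaws n, IsProbabilityMeasure P ∧ P.map (fun x => -x) = P ∧
      ∀ (μ : EuclideanSpace ℝ (Fin n)) (β : Fin k → ℝ) (σ2 C : ℝ), μ.ofLp = X *ᵥ β → 0 < σ2 →
        prob μ σ2 ρ (WBar w X Z R r C) =
          P (pivotSet w (augX X Z) (augR R p) ((√σ2 * √(1 - ρ ^ 2))⁻¹ • (R *ᵥ β - r)) C) := by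
  obtain ⟨ζ, a, hζ, ha, rfl⟩ :
      ∃ ζ a : ℝ, (ζ = 1 ∨ ζ = -1) ∧ a ∈ Set.Ico (0 : ℝ) 1 ∧ ρ = ζ * a := by
    rcases le_total 0 ρ with h | h
    · exact ⟨1, ρ, Or.inl rfl, ⟨h, hρ.2⟩, by ring⟩
    · exact ⟨-1, -ρ, Or.inr rfl, ⟨by linarith, by linarith [hρ.1]⟩, by ring⟩
  have hsq : (ζ * a) ^ 2 = a ^ 2 := by rcases hζ with rfl | rfl <;> ring
  have hs : 0 < √(1 - a ^ 2) := Real.sqrt_pos.2 (by nlinarith [ha.1, ha.2])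
  refine ⟨_, ⟨(ζ, a), ⟨by simpa using hζ, ha.1, ha.2.le⟩, rfl⟩, inferInstance, gaussLaw_map_neg _,
    fun μ β σ2 C hμ hσ => ?_⟩
  rw [hsq]
  exact prob_eq_gaussLaw_of_eq hA hμ hσ hs hρ (hplus.pow hminus hζ) (arChol_eq n hζ ha) C

end Reduction

/-! ### Distance to the null hypothesis -/

section Distance

variable {n k q : ℕ} {X : Matrix (Fin n) (Fin k) ℝ} {R : Matrix (Fin q) (Fin k) ℝ}

lemma exists_bound_mulVec_toLp {m l : ℕ} (M : Matrix (Fin m) (Fin l) ℝ) :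
    ∃ κ > 0, ∀ v, ‖WithLp.toLp 2 (M *ᵥ v)‖ ≤ κ * ‖v‖ := by
  let f : (Fin l → ℝ) →L[ℝ] EuclideanSpace ℝ (Fin m) := LinearMap.toContinuousLinearMap
    ((WithLp.linearEquiv 2 ℝ (Fin m → ℝ)).symm.toLinearMap ∘ₗ M.mulVecLin)
  exact ⟨‖f‖ + 1, by positivity, fun v => (f.le_opNorm v).trans (by gcongr; simp)⟩

lemma exists_bound_mulVec_ofLp {m l : ℕ} (M : Matrix (Fin m) (Fin l) ℝ) :
    ∃ κ > 0, ∀ x : EuclideanSpace ℝ (Fin l), ‖M *ᵥ x.ofLp‖ ≤ κ * ‖x‖ := by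
  let f : EuclideanSpace ℝ (Fin l) →L[ℝ] (Fin m → ℝ) := LinearMap.toContinuousLinearMap
    (M.mulVecLin ∘ₗ (WithLp.linearEquiv 2 ℝ (Fin l → ℝ)).toLinearMap)
  exact ⟨‖f‖ + 1, by positivity, fun v => (f.le_opNorm v).trans (by gcongr; simp)⟩

/-- The right inverse `R'(RR')⁻¹` moves `β` onto the restriction by a correction linear in `Rβ - r`.
Distance from the null thus forces a large shift. -/
lemma exists_infDist_le (X : Matrix (Fin n) (Fin k) ℝ) (hR : R.rank = q) (r : Fin q → ℝ) :
    ∃ κ > 0, ∀ (μ : EuclideanSpace ℝ (Fin n)) (β : Fin k → ℝ), μ.ofLp = X *ᵥ β →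
      Metric.infDist μ (nullSet X R r) ≤ κ * ‖R *ᵥ β - r‖ := by
  have hu : IsUnit (R * Rᵀ).det :=
    isUnit_det_of_rank_eq_card (by rw [rank_self_mul_transpose, hR, Fintype.card_fin])
  obtain ⟨κ, hκ, h⟩ := exists_bound_mulVec_toLp (X * (Rᵀ * (R * Rᵀ)⁻¹))
  refine ⟨κ, hκ, fun μ β hμ => ?_⟩
  set δ := R *ᵥ β - r with hδ
  set μ₀ : EuclideanSpace ℝ (Fin n) :=
    WithLp.toLp 2 (X *ᵥ (β - (Rᵀ * (R * Rᵀ)⁻¹) *ᵥ δ)) with hμ₀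
  have hmem : μ₀ ∈ nullSet X R r := by
    refine ⟨β - (Rᵀ * (R * Rᵀ)⁻¹) *ᵥ δ, rfl, ?_⟩
    rw [mulVec_sub, mulVec_mulVec, ← Matrix.mul_assoc, mul_nonsing_inv _ hu, one_mulVec, hδ,
      sub_sub_cancel]
  refine (Metric.infDist_le_dist_of_mem hmem).trans ?_
  rw [dist_eq_norm]
  refine le_trans (le_of_eq ?_) (h δ)
  congr 1
  apply WithLp.ofLp_injective
  rw [WithLp.ofLp_sub, hμ, hμ₀]
  simp only [mulVec_sub, sub_sub_cancel, mulVec_mulVec]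

/-- Needed so that the power infima range over a nonempty set: an empty infimum in `ℝ≥0∞` is `⊤`,
not at most one. -/
lemma exists_mem_altSet_le_infDist (hq : 1 ≤ q) (hX : X.rank = k) (hR : R.rank = q)
    (r : Fin q → ℝ) (c : ℝ) :
    ∃ μ ∈ altSet X R r, c ≤ Metric.infDist μ (nullSet X R r) := by
  have hu : IsUnit (Xᵀ * X).det := isUnit_gram (by rw [hX, Fintype.card_fin])
  have hR' : R.rank = Fintype.card (Fin q) := by rw [hR, Fintype.card_fin]
  obtain ⟨κ, hκ, h⟩ := exists_bound_mulVec_ofLp (hat X R)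
  set e : Fin q → ℝ := Pi.single ⟨0, hq⟩ 1 with he
  have hnorm : ‖e‖ = 1 := by rw [he, Pi.norm_single, norm_one]
  -- Since `hat X R` expands lengths by at most `κ`, this violation of the restriction puts the mean
  -- at distance at least `max c 1` from the null; the `1` keeps it off the null set when `c ≤ 0`.
  obtain ⟨β, hβ⟩ := exists_mulVec_eq_of_rank hR' (r + (κ * max c 1) • e)
  obtain ⟨β₀, hβ₀⟩ := exists_mulVec_eq_of_rank hR' r
  have hlow : ∀ μ₀ ∈ nullSet X R r, max c 1 ≤ dist (WithLp.toLp 2 (X *ᵥ β)) μ₀ := by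
    rintro μ₀ ⟨b, hb, hbr⟩
    have h1 := h (WithLp.toLp 2 (X *ᵥ β) - μ₀)
    rw [WithLp.ofLp_sub, hb, mulVec_sub, hat_mulVec, hat_mulVec, ols_mulVec hu, ols_mulVec hu, hβ,
      hbr, add_sub_cancel_left, norm_smul, hnorm, mul_one, ← dist_eq_norm, Real.norm_eq_abs,
      abs_of_nonneg (by positivity)] at h1
    exact le_of_mul_le_mul_left h1 hκ
  refine ⟨WithLp.toLp 2 (X *ᵥ β), ⟨mem_colSpan_iff.2 ⟨β, rfl⟩, fun hmem => ?_⟩, ?_⟩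
  · have := hlow _ hmem
    rw [dist_self] at this
    linarith [le_max_right c 1]
  · have hne : (nullSet X R r).Nonempty := ⟨WithLp.toLp 2 (X *ᵥ β₀), β₀, rfl, hβ₀⟩
    exact (le_max_left c 1).trans ((Metric.le_infDist hne).2 fun {y} hy => hlow y hy)

end Distance

/-! ### Size, power and critical values -/

section Conclusions

open scoped ENNReal
open Filter

lemma one_sub_le_of_compl_le {α : Type*} [MeasurableSpace α] {P : Measure α}
    [IsProbabilityMeasure P] {S : Set α} {ε : ℝ≥0∞} (h : P Sᶜ ≤ ε) : 1 - ε ≤ P S := by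
  rw [tsub_le_iff_right]
  calc (1 : ℝ≥0∞) = P Set.univ := measure_univ.symm
    _ = P (S ∪ Sᶜ) := by rw [Set.union_compl_self]
    _ ≤ P S + P Sᶜ := measure_union_le _ _
    _ ≤ P S + ε := by gcongr

lemma tendsto_one_of_eventually {f : ℕ → ℝ≥0∞} (h1 : ∀ᶠ m in atTop, f m ≤ 1)
    (h : ∀ ε > 0, ∀ᶠ m in atTop, 1 - ε ≤ f m) : Tendsto f atTop (nhds 1) := by
  refine ENNReal.tendsto_nhds_of_Icc fun ε hε => ?_
  filter_upwards [h1, h ε hε] with m hm hm'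
  exact ⟨hm', hm.trans le_self_add⟩

lemma prob_le_one {n : ℕ} (μ : EuclideanSpace ℝ (Fin n)) (σ2 ρ : ℝ)
    (W : Set (EuclideanSpace ℝ (Fin n))) : prob μ σ2 ρ W ≤ 1 :=
  MeasureTheory.prob_le_one

variable {n k q p : ℕ} {X : Matrix (Fin n) (Fin k) ℝ} {R : Matrix (Fin q) (Fin k) ℝ}
  {Z : Matrix (Fin n) (Fin p) ℝ} {w : ℤ → ℝ}

lemma exists_of_mem_altSet {r : Fin q → ℝ} {μ : EuclideanSpace ℝ (Fin n)}
    (h : μ ∈ altSet X R r) : ∃ β, μ.ofLp = X *ᵥ β := by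
  obtain ⟨β, hβ⟩ := mem_colSpan_iff.1 h.1
  exact ⟨β, hβ.symm⟩

/-- The power tends to one far from the null hypothesis if `ρ` is bounded away from `±1`. -/
theorem tendsto_power_of_distance (hq : 1 ≤ q) (hX : X.rank = k) (hR : R.rank = q)
    (r : Fin q → ℝ) (hw : WeightCondition n w) (hA : (augX X Z).rank = k + p)
    (hD : DesignCondition (augX X Z) (augR R p)) (C : ℝ) {c σ2 : ℕ → ℝ} {ε : ℝ}
    (hσ : ∀ m, 0 < σ2 m) (hε : 0 < ε) (hε1 : ε < 1)
    (hlim : Tendsto (fun m => c m / √(σ2 m)) atTop atTop) :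
    Tendsto (fun m => ⨅ μ₁ ∈ altSet X R r, ⨅ _ : c m ≤ Metric.infDist μ₁ (nullSet X R r),
      ⨅ ρ ∈ Set.Icc (-1 + ε) (1 - ε), prob μ₁ (σ2 m) ρ (WBar w X Z R r C)) atTop (nhds 1) := by
  have hsub : ∀ ρ ∈ Set.Icc (-1 + ε) (1 - ε), ρ ∈ Set.Ioo (-1 : ℝ) 1 := fun ρ hρ =>
    ⟨by linarith [hρ.1], by linarith [hρ.2]⟩
  have hU := uniformlyEquivalent_gaussLaw (isCompact_Icc (a := -1 + ε) (b := 1 - ε))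
    (continuous_arChol n).continuousOn fun ρ hρ => det_arChol_ne_zero n (hsub ρ hρ)
  obtain ⟨κ, hκ, hdist⟩ := exists_infDist_le X hR r
  refine tendsto_one_of_eventually (Eventually.of_forall fun m => ?_) fun e he => ?_
  · obtain ⟨μ, hμ, hμc⟩ := exists_mem_altSet_le_infDist hq hX hR r (c m)
    exact iInf₂_le_of_le μ hμ (iInf_le_of_le hμc
      (iInf₂_le_of_le 0 ⟨by linarith, by linarith⟩ (prob_le_one _ _ _ _)))
  · obtain ⟨K, hK⟩ := exists_measure_compl_pivotSet_le hw hD C hU he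
    -- Distance at least `c m` gives `‖Rβ - r‖ / σ ≥ c m / (κ σ)`, which exceeds `K` from this point
    -- on.
    filter_upwards [hlim.eventually_ge_atTop (κ * K)] with m hm
    refine le_iInf₂ fun μ hμ => le_iInf fun hμc => le_iInf₂ fun ρ hρ => ?_
    obtain ⟨β, hβ⟩ := exists_of_mem_altSet hμ
    rw [prob_eq_gaussLaw_arChol hA hβ (hσ m) (hsub ρ hρ)]
    refine one_sub_le_of_compl_le (hK _ ?_ _ (Set.mem_image_of_mem _ hρ))
    have hs : 0 < √(σ2 m) := Real.sqrt_pos.2 (hσ m)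
    rw [norm_smul, norm_inv, Real.norm_of_nonneg hs.le, ← div_eq_inv_mul, le_div_iff₀ hs]
    rw [le_div_iff₀ hs] at hm
    have := hμc.trans (hdist μ β hβ)
    exact le_of_mul_le_mul_left (by linarith) hκ

/-- The power tends to one along every sequence `ρ` with `|ρ| → 1`. -/
theorem tendsto_power_of_abs_tendsto_one (hq : 1 ≤ q) (hX : X.rank = k) (hR : R.rank = q)
    (r : Fin q → ℝ) (hw : WeightCondition n w) (hA : (augX X Z).rank = k + p)
    (hD : DesignCondition (augX X Z) (augR R p)) (hplus : Absorbed X R Z (ePlus n))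
    (hminus : Absorbed X R Z (eMinus n)) (C : ℝ) {c : ℝ} (hc : 0 < c) {ρ : ℕ → ℝ}
    (hρ : ∀ m, ρ m ∈ Set.Ioo (-1 : ℝ) 1)
    (hlim : Tendsto (fun m => |ρ m|) atTop (nhds 1)) :
    Tendsto (fun m => ⨅ μ₁ ∈ altSet X R r, ⨅ σ2 ∈ Set.Ioi (0 : ℝ),
      ⨅ _ : c ≤ Metric.infDist μ₁ (nullSet X R r) / √σ2,
        prob μ₁ σ2 (ρ m) (WBar w X Z R r C)) atTop (nhds 1) := by
  obtain ⟨κ, hκ, hdist⟩ := exists_infDist_le X hR r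
  refine tendsto_one_of_eventually (Eventually.of_forall fun m => ?_) fun e he => ?_
  · obtain ⟨μ, hμ, hμc⟩ := exists_mem_altSet_le_infDist hq hX hR r c
    exact iInf₂_le_of_le μ hμ (iInf₂_le_of_le 1 (Set.mem_Ioi.2 one_pos)
      (iInf_le_of_le (by simpa using hμc) (prob_le_one _ _ _ _)))
  · obtain ⟨K, hK⟩ := exists_measure_compl_pivotSet_le hw hD C (uniformlyEquivalent_arLaws n) he
    -- The shift has norm at least `c / (κ √(1 - ρ²))`, uniformly in the mean and in `σ`; it reaches
    -- `K` once `κ K √(1 - ρ²) < c`.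
    have h0 : Tendsto (fun m => κ * K * √(1 - ρ m ^ 2)) atTop (nhds 0) := by
      have h1 : Tendsto (fun m => κ * K * √(1 - |ρ m| ^ 2)) atTop
          (nhds (κ * K * √(1 - 1 ^ 2))) :=
        ((tendsto_const_nhds.sub (hlim.pow 2)).sqrt).const_mul _
      simpa using h1
    filter_upwards [h0.eventually (gt_mem_nhds hc)] with m hm
    refine le_iInf₂ fun μ hμ => le_iInf₂ fun σ2 hσ => le_iInf fun hμc => ?_
    obtain ⟨β, hβ⟩ := exists_of_mem_altSet hμ
    obtain ⟨P, hP, _, _, hprob⟩ := exists_mem_arLaws hA hplus hminus w r (hρ m)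
    rw [hprob μ β σ2 C hβ hσ]
    refine one_sub_le_of_compl_le (hK _ ?_ _ hP)
    have hs : 0 < √σ2 := Real.sqrt_pos.2 hσ
    have hs' : 0 < √(1 - ρ m ^ 2) :=
      Real.sqrt_pos.2 (by nlinarith [(hρ m).1, (hρ m).2])
    rw [norm_smul, norm_inv, Real.norm_of_nonneg (by positivity), ← div_eq_inv_mul,
      le_div_iff₀ (by positivity)]
    rw [le_div_iff₀ hs] at hμc
    have h1 := hμc.trans (hdist μ β hβ)
    have h2 : κ * K * √(1 - ρ m ^ 2) * √σ2 ≤ c * √σ2 := by gcongr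
    exact le_of_mul_le_mul_left (by linarith) hκ

lemma exists_law_of_mem_nullSet (hA : (augX X Z).rank = k + p)
    (hplus : Absorbed X R Z (ePlus n)) (hminus : Absorbed X R Z (eMinus n)) (w : ℤ → ℝ)
    {r : Fin q → ℝ} {μ : EuclideanSpace ℝ (Fin n)} (hμ : μ ∈ nullSet X R r) {σ2 ρ : ℝ}
    (hσ : σ2 ∈ Set.Ioi (0 : ℝ)) (hρ : ρ ∈ Set.Ioo (-1 : ℝ) 1) :
    ∃ P ∈ arLaws n, IsProbabilityMeasure P ∧ ∀ C,
      prob μ σ2 ρ (WBar w X Z R r C) = P (pivotSet w (augX X Z) (augR R p) 0 C) := by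
  obtain ⟨P, hP, hP1, _, hprob⟩ := exists_mem_arLaws hA hplus hminus w r hρ
  obtain ⟨β, hβ, hβr⟩ := hμ
  refine ⟨P, hP, hP1, fun C => ?_⟩
  rw [hprob μ β σ2 C hβ hσ, hβr, sub_self, smul_zero]

theorem size_and_infimal_power (hq : 1 ≤ q) (hR : R.rank = q)
    (r : Fin q → ℝ) (hw : WeightCondition n w) (hA : (augX X Z).rank = k + p)
    (hD : DesignCondition (augX X Z) (augR R p)) (hplus : Absorbed X R Z (ePlus n))
    (hminus : Absorbed X R Z (eMinus n)) {C : ℝ} (hC : 0 < C) :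
    ((⨆ μ₀ ∈ nullSet X R r, ⨆ σ2 ∈ Set.Ioi (0 : ℝ), ⨆ ρ ∈ Set.Ioo (-1 : ℝ) 1,
        prob μ₀ σ2 ρ (WBar w X Z R r C)) < 1 ∧
      0 < ⨅ μ₀ ∈ nullSet X R r, ⨅ σ2 ∈ Set.Ioi (0 : ℝ), ⨅ ρ ∈ Set.Ioo (-1 : ℝ) 1,
        prob μ₀ σ2 ρ (WBar w X Z R r C)) ∧
    0 < ⨅ μ₁ ∈ altSet X R r, ⨅ σ2 ∈ Set.Ioi (0 : ℝ), ⨅ ρ ∈ Set.Ioo (-1 : ℝ) 1,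
        prob μ₁ σ2 ρ (WBar w X Z R r C) := by
  obtain ⟨b, hb, hbP⟩ := exists_pos_le_measure_pivotSet hw hq (isUnit_gram (by simpa using hA))
    (rank_augR hR p) hD hC (uniformlyEquivalent_arLaws n)
  refine ⟨⟨?_, ?_⟩, ?_⟩
  · refine lt_of_le_of_lt (b := 1 - b) ?_
      (ENNReal.sub_lt_self ENNReal.one_ne_top one_ne_zero hb.ne')
    refine iSup₂_le fun μ hμ => iSup₂_le fun σ2 hσ => iSup₂_le fun ρ hρ => ?_
    obtain ⟨P, hP, _, hprob⟩ := exists_law_of_mem_nullSet hA hplus hminus w hμ hσ hρ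
    have h1 := (hbP P hP).2
    rw [hprob C]
    rw [prob_compl_eq_one_sub (measurableSet_pivotSet _ _ _ _ _)] at h1
    exact ENNReal.le_sub_of_add_le_left (ne_top_of_le_ne_top ENNReal.one_ne_top
      (h1.trans tsub_le_self)) (add_le_of_le_tsub_right_of_le MeasureTheory.prob_le_one h1)
  · refine hb.trans_le (le_iInf₂ fun μ hμ => le_iInf₂ fun σ2 hσ => le_iInf₂ fun ρ hρ => ?_)
    obtain ⟨P, hP, _, hprob⟩ := exists_law_of_mem_nullSet hA hplus hminus w hμ hσ hρ
    rw [hprob C]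
    exact (hbP P hP).1
  -- Half of the null bound survives an arbitrary shift, by the reflection symmetry of the laws.
  · refine (ENNReal.half_pos hb.ne').trans_le
      (le_iInf₂ fun μ hμ => le_iInf₂ fun σ2 hσ => le_iInf₂ fun ρ hρ => ?_)
    obtain ⟨β, hβ⟩ := exists_of_mem_altSet hμ
    obtain ⟨P, hP, _, hneg, hprob⟩ := exists_mem_arLaws hA hplus hminus w r hρ
    rw [hprob μ β σ2 C hβ hσ]
    exact ENNReal.div_le_of_le_mul'
      ((hbP P hP).1.trans (measure_pivotSet_zero_le hw hC _ hneg))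

theorem exists_critical_value (hA : (augX X Z).rank = k + p) (r : Fin q → ℝ) (w : ℤ → ℝ)
    (hplus : Absorbed X R Z (ePlus n)) (hminus : Absorbed X R Z (eMinus n)) {δ : ℝ}
    (hδ : 0 < δ) :
    ∃ C : ℝ, 0 < C ∧
      (⨆ μ₀ ∈ nullSet X R r, ⨆ σ2 ∈ Set.Ioi (0 : ℝ), ⨆ ρ ∈ Set.Ioo (-1 : ℝ) 1,
        prob μ₀ σ2 ρ (WBar w X Z R r C)) ≤ ENNReal.ofReal δ := by
  obtain ⟨C, hC, h⟩ := exists_measure_pivotSet_le w (augX X Z) (augR R p)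
    (uniformlyEquivalent_arLaws n) (ENNReal.ofReal_pos.2 hδ)
  refine ⟨C, hC, iSup₂_le fun μ hμ => iSup₂_le fun σ2 hσ => iSup₂_le fun ρ hρ => ?_⟩
  obtain ⟨P, hP, _, hprob⟩ := exists_law_of_mem_nullSet hA hplus hminus w hμ hσ hρ
  rw [hprob C]
  exact h P hP

end Conclusions

end HAR

theorem theorem3p5 {n k q : ℕ} (hk : 1 ≤ k) (hkn : k < n) (hq : 1 ≤ q)
    (X : Matrix (Fin n) (Fin k) ℝ) (hX : X.rank = k)
    (R : Matrix (Fin q) (Fin k) ℝ) (hR : R.rank = q) (r : Fin q → ℝ)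
    (w : ℤ → ℝ) (hw : HAR.WeightCondition n w) :
    -- all conclusions, in each of the five scenarios
    (∀ (p : ℕ) (Z : Matrix (Fin n) (Fin p) ℝ), HAR.Scenario X R p Z →
      (∀ C : ℝ, 0 < C →
        -- size less than one, and rejection probabilities under the null bounded away from zero
        ((⨆ μ₀ ∈ HAR.nullSet X R r, ⨆ σ2 ∈ Set.Ioi (0 : ℝ), ⨆ ρ ∈ Set.Ioo (-1 : ℝ) 1,
            HAR.prob μ₀ σ2 ρ (HAR.WBar w X Z R r C)) < 1 ∧
         0 < ⨅ μ₀ ∈ HAR.nullSet X R r, ⨅ σ2 ∈ Set.Ioi (0 : ℝ), ⨅ ρ ∈ Set.Ioo (-1 : ℝ) 1,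
            HAR.prob μ₀ σ2 ρ (HAR.WBar w X Z R r C)) ∧
        -- infimal power bounded away from zero
        (0 < ⨅ μ₁ ∈ HAR.altSet X R r, ⨅ σ2 ∈ Set.Ioi (0 : ℝ), ⨅ ρ ∈ Set.Ioo (-1 : ℝ) 1,
            HAR.prob μ₁ σ2 ρ (HAR.WBar w X Z R r C)) ∧
        -- power tending to one as `|ρ| → 1`
        (∀ c : ℝ, 0 < c → ∀ ρ : ℕ → ℝ, (∀ m, ρ m ∈ Set.Ioo (-1 : ℝ) 1) →
          Filter.Tendsto (fun m => |ρ m|) Filter.atTop (nhds 1) →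
          Filter.Tendsto
            (fun m => ⨅ μ₁ ∈ HAR.altSet X R r, ⨅ σ2 ∈ Set.Ioi (0 : ℝ),
              ⨅ _ : c ≤ Metric.infDist μ₁ (HAR.nullSet X R r) / Real.sqrt σ2,
                HAR.prob μ₁ σ2 (ρ m) (HAR.WBar w X Z R r C))
            Filter.atTop (nhds 1)) ∧
        -- power tending to one as `c_m / σ_m → ∞`, with `ρ` bounded away from `±1`
        (∀ (c σ2 : ℕ → ℝ) (ε : ℝ), (∀ m, 0 < c m) → (∀ m, 0 < σ2 m) → 0 < ε → ε < 1 →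
          Filter.Tendsto (fun m => c m / Real.sqrt (σ2 m)) Filter.atTop Filter.atTop →
          Filter.Tendsto
            (fun m => ⨅ μ₁ ∈ HAR.altSet X R r,
              ⨅ _ : c m ≤ Metric.infDist μ₁ (HAR.nullSet X R r),
              ⨅ ρ ∈ Set.Icc (-1 + ε) (1 - ε),
                HAR.prob μ₁ (σ2 m) ρ (HAR.WBar w X Z R r C))
            Filter.atTop (nhds 1))) ∧
      -- the size can be controlled by the choice of the critical value
      (∀ δ : ℝ, 0 < δ → δ < 1 → ∃ Cδ : ℝ, 0 < Cδ ∧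
        (⨆ μ₀ ∈ HAR.nullSet X R r, ⨆ σ2 ∈ Set.Ioi (0 : ℝ), ⨆ ρ ∈ Set.Ioo (-1 : ℝ) 1,
            HAR.prob μ₀ σ2 ρ (HAR.WBar w X Z R r Cδ)) ≤ ENNReal.ofReal δ)) ∧
    -- the last convergence holds even without the conditions on `e₊` and `e₋`
    (∀ (p : ℕ) (Z : Matrix (Fin n) (Fin p) ℝ), HAR.AuxRegressors n p Z →
      (HAR.augX X Z).rank = k + p → k + p < n →
      HAR.DesignCondition (HAR.augX X Z) (HAR.augR R p) →
      ∀ C : ℝ, 0 < C →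
        ∀ (c σ2 : ℕ → ℝ) (ε : ℝ), (∀ m, 0 < c m) → (∀ m, 0 < σ2 m) → 0 < ε → ε < 1 →
          Filter.Tendsto (fun m => c m / Real.sqrt (σ2 m)) Filter.atTop Filter.atTop →
          Filter.Tendsto
            (fun m => ⨅ μ₁ ∈ HAR.altSet X R r,
              ⨅ _ : c m ≤ Metric.infDist μ₁ (HAR.nullSet X R r),
              ⨅ ρ ∈ Set.Icc (-1 + ε) (1 - ε),
                HAR.prob μ₁ (σ2 m) ρ (HAR.WBar w X Z R r C))
            Filter.atTop (nhds 1)) := by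
  refine ⟨fun p Z hZ => ?_, fun p Z _ hA _ hD C _ c σ2 ε _ hσ hε hε1 hlim =>
    HAR.tendsto_power_of_distance hq hX hR r hw hA hD C hσ hε hε1 hlim⟩
  obtain ⟨hA, hD, hplus, hminus⟩ := hZ.spec hX
  refine ⟨fun C hC => ?_, fun δ hδ _ => HAR.exists_critical_value hA r w hplus hminus hδ⟩
  obtain ⟨hsize, hpower⟩ := HAR.size_and_infimal_power hq hR r hw hA hD hplus hminus hC
  exact ⟨hsize, hpower, fun c hc ρ hρ hlim =>
    HAR.tendsto_power_of_abs_tendsto_one hq hX hR r hw hA hD hplus hminus C hc hρ hlim,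
    fun c σ2 ε _ hσ hε hε1 hlim =>
      HAR.tendsto_power_of_distance hq hX hR r hw hA hD C hσ hε hε1 hlim⟩
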